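/- Let $M$ be a melon graph, i.e. a finite simple graph that is the union of $m\ge 1$ distinct paths of positive length which have the same two distinct endpoints and are otherwise pairwise vertex-disjoint (since $M$ is simple, at most one of these paths has length one). A word over the vertex set $V$ of a graph $G$ represents $G$ if, for all distinct $a,b\in V$, the vertices $a,b$ are adjacent if and only if they alternate in the word, meaning that deleting all other letters leaves a word of the form $abab\cdots$ or $baba\cdots$ (of even or odd length). The representation number $\mathcal R(G)$ is the smallest positive integer $k$ such that $G$ is represented by a word in which every vertex occurs exactly $k$ times. Let $M_3$ be the melon graph consisting of three paths, each of length exactly three, and let $B_3$ be the book graph with three pages, i.e. the melon graph consisting of one path of length one and three paths of length three. The local complement of a graph at a vertex $v$ is obtained by complementing the edges of the subgraph induced by the neighbourhood of $v$; a graph $G$ contains $H$ as a vertex-minor if a graph isomorphic to $H$ is obtained from $G$ by a finite (possibly empty) sequence of vertex deletions and local complementations. Then $\mathcal R(M)=3$ if and only if $M$ contains $M_3$ or $B_3$ as a vertex-minor. -/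

import Mathlib

/-- Two letters `a`, `b` alternate in the word `w`: the subword of `w` consisting of all occurrences
of `a` and `b` is `abab...` or `baba...` (of any length), that is, no two consecutive letters
of that subword are equal. -/
def Alternate {V : Type*} [DecidableEq V] (w : List V) (a b : V) : Prop :=
  (w.filter fun x => x = a ∨ x = b).IsChain (· ≠ ·)

/-- The word `w` over the vertex set represents `G`: two distinct vertices are adjacent exactly when
they alternate in `w`. -/
def Represents {V : Type*} [DecidableEq V] (w : List V) (G : SimpleGraph V) : Prop :=
  ∀ a b : V, a ≠ b → (G.Adj a b ↔ Alternate w a b)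

/-- `G` is `k`-word-representable: it is represented by a word in which every vertex occurs
exactly `k` times. -/
def IsKWordRepresentable {V : Type*} [DecidableEq V] (k : ℕ) (G : SimpleGraph V) : Prop :=
  ∃ w : List V, (∀ v : V, w.count v = k) ∧ Represents w G

/-- The representation number: the smallest positive `k` such that `G` is `k`-word-representable
(the value is `0` exactly if there is no such `k`). -/
noncomputable def representationNumber {V : Type*} [DecidableEq V] (G : SimpleGraph V) : ℕ :=
  sInf {k : ℕ | 1 ≤ k ∧ IsKWordRepresentable k G}

/-- The vertices of the melon graph whose constituent paths have lengths `ℓ 0, …, ℓ (m - 1)`: the two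
common endpoints and, for every `i`, the `ℓ i - 1` internal vertices of the `i`-th path. -/
inductive MelonVertex {m : ℕ} (ℓ : Fin m → ℕ) : Type
  | source : MelonVertex ℓ
  | sink : MelonVertex ℓ
  | inner (i : Fin m) (j : Fin (ℓ i - 1)) : MelonVertex ℓ

/-- The `j`-th vertex of the `i`-th constituent path, for `0 ≤ j ≤ ℓ i`: the path starts in `source`
(`j = 0`), runs through its internal vertices and ends in `sink` (`j = ℓ i`). -/
def melonPathVertex {m : ℕ} (ℓ : Fin m → ℕ) (i : Fin m) (j : ℕ) : MelonVertex ℓ :=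
  if h0 : j = 0 then .source
  else if h : j < ℓ i then .inner i ⟨j - 1, by omega⟩
  else .sink

/-- The melon graph with constituent paths of lengths `ℓ 0, …, ℓ (m - 1)`: its edges are those
between consecutive vertices of the constituent paths. -/
def melonGraph {m : ℕ} (ℓ : Fin m → ℕ) : SimpleGraph (MelonVertex ℓ) :=
  SimpleGraph.fromRel fun x y =>
    ∃ i : Fin m, ∃ j < ℓ i, x = melonPathVertex ℓ i j ∧ y = melonPathVertex ℓ i (j + 1)

/-- `G` is a melon graph: up to isomorphism, it consists of `m ≥ 1` paths of positive length that
share their two (distinct) endpoints and are otherwise vertex-disjoint, at most one of them having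
length one. -/
def IsMelonGraph {V : Type*} (G : SimpleGraph V) : Prop :=
  ∃ (m : ℕ) (ℓ : Fin m → ℕ), 1 ≤ m ∧ (∀ i, 1 ≤ ℓ i) ∧ (∀ i j, ℓ i = 1 → ℓ j = 1 → i = j) ∧
    Nonempty (G ≃g melonGraph ℓ)

/-- The melon graph with three constituent paths, each of length exactly three. -/
def graphM3 : SimpleGraph (MelonVertex fun _ : Fin 3 => 3) :=
  melonGraph fun _ : Fin 3 => 3

/-- The book graph with `m` pages: the melon graph in which the endpoints are adjacent and which has
`m` further constituent paths, each of length three. -/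
def bookGraph (m : ℕ) : SimpleGraph (MelonVertex (Fin.cons 1 fun _ : Fin m => 3)) :=
  melonGraph (Fin.cons 1 fun _ : Fin m => 3)

/-- The local complement of `G` at `v`: the adjacencies between neighbours of `v` are complemented and
all others are kept. -/
def localComplement {V : Type*} (G : SimpleGraph V) (v : V) : SimpleGraph V where
  Adj a b := a ≠ b ∧ Xor (G.Adj a b) (G.Adj v a ∧ G.Adj v b)
  symm := ⟨fun a b h => by
    simpa only [ne_comm, G.adj_comm b a, and_comm (a := G.Adj v b)] using h⟩
  loopless := ⟨fun _ h => h.1 rfl⟩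

/-- `G` contains `H` as a vertex-minor: a graph isomorphic to `H` is obtained from `G` by a finite
sequence of vertex deletions and local complementations. -/
inductive ContainsVertexMinor.{u, v} {W : Type v} (H : SimpleGraph W) :
    {V : Type u} → SimpleGraph V → Prop
  | of_iso {V : Type u} {G : SimpleGraph V} (e : G ≃g H) : ContainsVertexMinor H G
  | delete {V : Type u} {G : SimpleGraph V} (v : V)
      (h : ContainsVertexMinor H (G.induce {v}ᶜ)) : ContainsVertexMinor H G
  | local_complement {V : Type u} {G : SimpleGraph V} (v : V)
      (h : ContainsVertexMinor H (localComplement G v)) : ContainsVertexMinor H G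

/-! Every melon graph is represented by an explicit word with three occurrences of each vertex. Two
occurrences per vertex suffice exactly for circle graphs (read the two occurrences of a letter as
the ends of a chord: alternation is crossing), and a graph with a word using each letter once is
complete, hence also a circle graph. So the representation number of a melon graph is 3 if and only
if it is not a circle graph (`representationNumber_eq_three_iff`, `isPlacement_melonPlace`).

Circle graphs are closed under vertex-minors: local complementation at `v` reverses the part of the
word between the two occurrences of `v`. Neither `graphM3` nor `bookGraph 3` is a circle graph: in a
chord diagram there are only two ways for a path of length three to lead from `s` to `t`, and two of
three paths choosing the same way would have to meet (`IsThreePaths.not_isCircleGraph`). This gives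
one direction.

For the other, call a path long if its length is at least three. With at most two long paths, each
gets a way of its own and a chord diagram can be written down (`isCircleGraph_melonGraph`). With
three long paths, the remaining paths of length at least two are deleted and the chosen long ones
are shortened to length three by local complementations; the result is `graphM3` or `bookGraph 3`,
according to whether the endpoints are adjacent (`melonGraph_containsVertexMinor`). -/

/-! ### Words as placements of letters in a linear order -/

/-- Between any two places of `a` there is a place of `b`. -/
def Separates {V α : Type*} [LinearOrder α] {k : ℕ} (p : V → Fin k → α) (a b : V) : Prop :=
  ∀ i j, p a i < p a j → ∃ l, p a i < p b l ∧ p b l < p a j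

/-- The places `p v 0, …, p v (k - 1)` of the letters `v` describe, when read in increasing order,
a word in which every letter occurs `k` times and which represents `G`. -/
structure IsPlacement {V α : Type*} [LinearOrder α] {k : ℕ} (p : V → Fin k → α)
    (G : SimpleGraph V) : Prop where
  injective : Function.Injective fun x : V × Fin k => p x.1 x.2
  adj_iff : ∀ a b, a ≠ b → (G.Adj a b ↔ Separates p a b ∧ Separates p b a)

theorem alternate_iff {V : Type*} [DecidableEq V] (w : List V) (a b : V) :
    Alternate w a b ↔ ∀ A x B C, w = A ++ x :: (B ++ x :: C) → x = a ∨ x = b →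
      ∃ y ∈ B, y = a ∨ y = b := by
  unfold Alternate
  constructor
  · rintro h A x B C rfl hx
    by_contra! hB
    have hBn : B.filter (fun x => decide (x = a ∨ x = b)) = [] := by
      rw [List.filter_eq_nil_iff]
      intro y hy
      simpa using hB y hy
    simp only [List.filter_append, List.filter_cons, hx, decide_true, if_true, hBn,
      List.nil_append] at h
    have := (List.isChain_append.1 h).2.1
    simp at this
  · intro h
    rw [List.isChain_iff_forall_rel_of_append_cons_cons]
    intro x y l₁ l₂ hl hxy
    subst hxy
    obtain ⟨A, D, rfl, -, hD⟩ := List.filter_eq_append_iff.1 hl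
    obtain ⟨A', D', rfl, -, hx, hD'⟩ := List.filter_eq_cons_iff.1 hD
    obtain ⟨B, C, rfl, hB, -, -⟩ := List.filter_eq_cons_iff.1 hD'
    obtain ⟨y, hy, hy'⟩ := h (A ++ A') x B C (by simp) (by simpa using hx)
    exact hB y hy (by simpa using hy')

theorem alternate_ofFn_iff {V : Type*} [DecidableEq V] {n : ℕ} (f : Fin n → V) (a b : V) :
    Alternate (List.ofFn f) a b ↔ ∀ i j, i < j → f i = f j → f i = a ∨ f i = b →
      ∃ l, i < l ∧ l < j ∧ (f l = a ∨ f l = b) := by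
  rw [alternate_iff]
  constructor
  · intro h i j hij hf hi
    have hlen : (List.ofFn f).length = n := List.length_ofFn
    obtain ⟨y, hy, hy'⟩ := h ((List.ofFn f).take i) (f i)
      (((List.ofFn f).drop (i + 1)).take (j - (i + 1))) ((List.ofFn f).drop (j + 1)) (by
        have h1 : (List.ofFn f).drop j = f j :: (List.ofFn f).drop (j + 1) := by
          rw [List.drop_eq_getElem_cons (by simp)]; simp
        have h2 : (List.ofFn f).drop i = f i :: (List.ofFn f).drop (i + 1) := by
          rw [List.drop_eq_getElem_cons (by simp)]; simp
        have h3 : (List.ofFn f).drop j =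
            ((List.ofFn f).drop (i + 1)).drop (j - (i + 1)) := by
          rw [List.drop_drop]; congr 1; have : i.1 < j.1 := hij; omega
        rw [hf, ← h1, h3, List.take_append_drop, ← hf, ← h2, List.take_append_drop]) hi
    obtain ⟨l, hl, rfl⟩ := List.getElem_of_mem hy
    simp only [List.length_take, List.length_drop, hlen] at hl
    simp only [List.getElem_take, List.getElem_drop, List.getElem_ofFn] at hy'
    refine ⟨⟨i + 1 + l, by omega⟩, ?_, ?_, hy'⟩
    · rw [Fin.lt_def]; simp; omega
    · rw [Fin.lt_def]; simp; omega
  · intro h A x B C hw hx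
    have hn : n = A.length + (1 + (B.length + (1 + C.length))) := by
      have := congrArg List.length hw
      simp at this; omega
    have key : ∀ (m : ℕ) (hm : m < n), f ⟨m, hm⟩ = (A ++ x :: (B ++ x :: C))[m]'(by
        simp; omega) := by
      intro m hm
      simp [← hw]
    have hi : f ⟨A.length, by omega⟩ = x := by rw [key]; simp
    have hj : f ⟨A.length + 1 + B.length, by omega⟩ = x := by
      rw [key, List.getElem_append_right (by omega)]
      simp [show A.length + 1 + B.length - A.length = B.length + 1 by omega]
    obtain ⟨l, hl1, hl2, hl⟩ := h _ _ (by rw [Fin.lt_def]; simp; omega) (hi.trans hj.symm)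
      (by rw [hi]; exact hx)
    rw [Fin.lt_def] at hl1 hl2
    simp only at hl1 hl2
    refine ⟨f l, ?_, hl⟩
    obtain ⟨d, hd⟩ : ∃ d, l.1 = A.length + (d + 1) := ⟨l.1 - A.length - 1, by omega⟩
    have : f l = B[d]'(by omega) := by
      have := key l.1 l.2
      simp only [hd] at this
      rw [show f l = f ⟨l.1, l.2⟩ from rfl]
      simp only [hd]
      rw [this, List.getElem_append_right (by omega)]
      simp [List.getElem_append_left (show d < B.length by omega)]
    rw [this]
    exact List.getElem_mem _

theorem count_ofFn {V : Type*} [DecidableEq V] {n : ℕ} (f : Fin n → V) (v : V) :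
    (List.ofFn f).count v = (Finset.univ.filter fun i => f i = v).card := by
  have := Fin.card_filter_univ_eq_vector_get_eq_count v (List.Vector.ofFn f)
  simpa [eq_comm] using this.symm

/-- Alternation of the letters of `f` in terms of the places `p`, where the `i`-th letter is the one
having the place `e i`. -/
theorem alternate_ofFn_iff_separates {V α : Type*} [DecidableEq V] [LinearOrder α] {n k : ℕ}
    (p : V → Fin k → α) (e : Fin n ≃ V × Fin k)
    (he : ∀ i j, i < j ↔ p (e i).1 (e i).2 < p (e j).1 (e j).2) (a b : V) (hab : a ≠ b) :
    Alternate (List.ofFn fun i => (e i).1) a b ↔ Separates p a b ∧ Separates p b a := by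
  rw [alternate_ofFn_iff]
  have key : ∀ a b : V, a ≠ b → (∀ i j, i < j → (e i).1 = (e j).1 → (e i).1 = a ∨ (e i).1 = b →
      ∃ l, i < l ∧ l < j ∧ ((e l).1 = a ∨ (e l).1 = b)) → Separates p a b := by
    intro a b hab h i j hij
    by_contra! hno
    -- take the last place of `a` before `p a j`
    have hne : (Finset.univ.filter fun l => p a l < p a j).Nonempty := ⟨i, by simpa using hij⟩
    obtain ⟨l, hl, hmax⟩ := Finset.exists_max_image _ (p a) hne
    simp only [Finset.mem_filter, Finset.mem_univ, true_and] at hl hmax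
    obtain ⟨c, hc1, hc2, hc⟩ := h (e.symm (a, l)) (e.symm (a, j))
      (by rw [he]; simpa using hl) (by simp) (by simp)
    rw [he] at hc1 hc2
    simp only [Equiv.apply_symm_apply] at hc1 hc2
    rcases hc with hc | hc
    · rw [hc] at hc1 hc2
      exact absurd (hmax _ hc2) (not_le.2 hc1)
    · rw [hc] at hc1 hc2
      exact absurd hc2 (not_lt.2 (hno _ ((hmax i hij).trans_lt hc1)))
  have key2 : ∀ a b : V, Separates p a b → ∀ i j, i < j → (e i).1 = (e j).1 → (e i).1 = a →
      ∃ l, i < l ∧ l < j ∧ (e l).1 = b := by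
    intro a b h i j hij hf hi
    rw [he, ← hf, hi] at hij
    obtain ⟨l, h1, h2⟩ := h _ _ hij
    refine ⟨e.symm (b, l), ?_, ?_, by simp⟩
    · rw [he, hi]; simpa using h1
    · rw [he, ← hf, hi]; simpa using h2
  constructor
  · intro h
    exact ⟨key a b hab h, key b a hab.symm fun i j hij hf hi => by
      simpa only [or_comm] using h i j hij hf hi.symm⟩
  · rintro ⟨h1, h2⟩ i j hij hf (hi | hi)
    · obtain ⟨l, hl⟩ := key2 a b h1 i j hij hf hi
      exact ⟨l, hl.1, hl.2.1, Or.inr hl.2.2⟩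
    · obtain ⟨l, hl⟩ := key2 b a h2 i j hij hf hi
      exact ⟨l, hl.1, hl.2.1, Or.inl hl.2.2⟩

/-- The word is obtained by sorting `V × Fin k` by place and keeping the first coordinates. An
arbitrary linear order of places allows lexicographic coordinates in later constructions. -/
theorem IsPlacement.isKWordRepresentable {V α : Type*} [DecidableEq V] [Finite V] [LinearOrder α]
    {k : ℕ} {p : V → Fin k → α} {G : SimpleGraph V} (hp : IsPlacement p G) :
    IsKWordRepresentable k G := by
  have := Fintype.ofFinite V
  let _ : LinearOrder (V × Fin k) := LinearOrder.lift' (fun x : V × Fin k => p x.1 x.2) hp.injective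
  let e := Fintype.orderIsoFinOfCardEq (V × Fin k) rfl
  refine ⟨List.ofFn fun i => (e i).1, fun v => ?_, fun a b hab => ?_⟩
  · rw [count_ofFn]
    calc _ = (Finset.univ.filter fun x : V × Fin k => x.1 = v).card :=
          Finset.card_equiv e.toEquiv (by simp)
      _ = (Finset.univ.image (Prod.mk v : Fin k → V × Fin k)).card := by
          congr 1; ext ⟨x, i⟩; simp [eq_comm]
      _ = k := by rw [Finset.card_image_of_injective _ (Prod.mk_right_injective v)]; simp
  · rw [hp.adj_iff a b hab]
    exact (alternate_ofFn_iff_separates p e.toEquiv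
      (fun i j => e.lt_iff_lt.symm) a b hab).symm

theorem IsKWordRepresentable.exists_placement {V : Type*} [DecidableEq V] {k : ℕ}
    {G : SimpleGraph V} (h : IsKWordRepresentable k G) :
    ∃ p : V → Fin k → ℤ, IsPlacement p G := by
  obtain ⟨w, hw, hG⟩ := h
  obtain ⟨n, f, rfl⟩ : ∃ n, ∃ f : Fin n → V, w = List.ofFn f := ⟨w.length, w.get, by simp⟩
  -- `o v` lists the positions of the letter `v` in increasing order.
  let o : ∀ v, Fin k ↪o Fin n := fun v =>
    (Finset.univ.filter fun i => f i = v).orderEmbOfFin ((count_ofFn f v).symm.trans (hw v))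
  have ho : ∀ v i, f (o v i) = v := fun v i => by
    have := Finset.orderEmbOfFin_mem (Finset.univ.filter fun i => f i = v)
      ((count_ofFn f v).symm.trans (hw v)) i
    exact (Finset.mem_filter.1 this).2
  have hsurj : ∀ i, ∃ l, o (f i) l = i := fun i => by
    have : i ∈ Set.range (o (f i)) := by
      rw [Finset.range_orderEmbOfFin]; simp
    exact this
  have hinj : Function.Injective fun x : V × Fin k => o x.1 x.2 := by
    rintro ⟨v, i⟩ ⟨v', i'⟩ h
    have hv : v = v' := by rw [← ho v i, ← ho v' i']; exact congrArg f h
    subst hv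
    simpa using h
  let e : V × Fin k ≃ Fin n := Equiv.ofBijective _
    ⟨hinj, fun i => (hsurj i).elim fun l hl => ⟨(f i, l), hl⟩⟩
  refine ⟨fun v i => ((o v i : ℕ) : ℤ), fun x y h => hinj (Fin.ext (by simpa using h)),
    fun a b hab => ?_⟩
  rw [hG a b hab]
  have he : f = fun i => (e.symm i).1 := by
    funext i
    obtain ⟨x, rfl⟩ := e.surjective i
    rw [Equiv.symm_apply_apply]
    exact ho x.1 x.2
  rw [he]
  refine alternate_ofFn_iff_separates (fun v i => ((o v i : ℕ) : ℤ)) e.symm (fun i j => ?_) a b hab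
  obtain ⟨x, rfl⟩ := e.surjective i
  obtain ⟨y, rfl⟩ := e.surjective j
  simp only [Equiv.symm_apply_apply, Nat.cast_lt]
  rfl

/-! ### Circle graphs and their closure under vertex-minors -/

/-- The chords with endpoints `l v < r v` have pairwise distinct endpoints, and two of them cross
exactly when their vertices are adjacent in `G`. -/
structure IsChordDiagram {V : Type*} (l r : V → ℤ) (G : SimpleGraph V) : Prop where
  lt : ∀ v, l v < r v
  ne : ∀ a b, a ≠ b → l a ≠ l b ∧ l a ≠ r b ∧ r a ≠ l b ∧ r a ≠ r b
  adj_iff : ∀ a b, a ≠ b → (G.Adj a b ↔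
    (l a < l b ∧ l b < r a ∧ r a < r b) ∨ (l b < l a ∧ l a < r b ∧ r b < r a))

/-- A circle graph, given by a chord diagram. -/
def IsCircleGraph {V : Type*} (G : SimpleGraph V) : Prop :=
  ∃ l r : V → ℤ, IsChordDiagram l r G

theorem IsPlacement.isCircleGraph {V : Type*} {G : SimpleGraph V} {p : V → Fin 2 → ℤ}
    (hp : IsPlacement p G) : IsCircleGraph G := by
  have hne : ∀ a b i j, (a, i) ≠ (b, j) → p a i ≠ p b j := fun a b i j h h' => h (hp.injective h')
  refine ⟨fun v => min (p v 0) (p v 1), fun v => max (p v 0) (p v 1), fun v => ?_,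
    fun a b hab => ?_, fun a b hab => ?_⟩
  · have := hne v v 0 1 (by simp)
    omega
  · have h1 := hne a b 0 0 (by simp [hab])
    have h2 := hne a b 0 1 (by simp)
    have h3 := hne a b 1 0 (by simp)
    have h4 := hne a b 1 1 (by simp [hab])
    omega
  · have h1 := hne a b 0 0 (by simp [hab])
    have h2 := hne a b 0 1 (by simp)
    have h3 := hne a b 1 0 (by simp)
    have h4 := hne a b 1 1 (by simp [hab])
    have h5 := hne a a 0 1 (by simp)
    have h6 := hne b b 0 1 (by simp)
    rw [hp.adj_iff a b hab]
    simp only [Separates, Fin.forall_fin_two, Fin.exists_fin_two]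
    generalize p a 0 = x at *
    generalize p a 1 = y at *
    generalize p b 0 = z at *
    generalize p b 1 = t at *
    clear hne hp
    rcases lt_or_gt_of_ne h5 with h5 | h5 <;> rcases lt_or_gt_of_ne h6 with h6 | h6 <;>
      simp only [min_eq_left h5.le, max_eq_right h5.le, min_eq_right h5.le, max_eq_left h5.le,
        min_eq_left h6.le, max_eq_right h6.le, min_eq_right h6.le, max_eq_left h6.le, lt_irrefl,
        h5, h6, h5.not_gt, h6.not_gt, false_imp_iff, true_imp_iff, true_and, and_true] <;> omega

theorem IsCircleGraph.exists_placement {V : Type*} {G : SimpleGraph V} (h : IsCircleGraph G) :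
    ∃ p : V → Fin 2 → ℤ, IsPlacement p G := by
  obtain ⟨l, r, h⟩ := h
  refine ⟨fun v => ![l v, r v], ?_, fun a b hab => ?_⟩
  · rintro ⟨a, i⟩ ⟨b, j⟩ hx
    by_cases hab : a = b
    · subst hab
      have := h.lt a
      fin_cases i <;> fin_cases j <;> simp at hx ⊢ <;> omega
    · have := h.ne a b hab
      fin_cases i <;> fin_cases j <;> simp at hx <;> omega
  · have h1 := h.lt a
    have h2 := h.lt b
    have h3 := h.ne a b hab
    rw [h.adj_iff a b hab]
    simp only [Separates, Fin.forall_fin_two, Fin.exists_fin_two, Matrix.cons_val_zero,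
      Matrix.cons_val_one, lt_irrefl, h1, h2, h1.not_gt, h2.not_gt, false_imp_iff, true_imp_iff,
      true_and, and_true]
    omega

theorem IsCircleGraph.comap {V W : Type*} {G : SimpleGraph V} {H : SimpleGraph W} (f : H ↪g G)
    (h : IsCircleGraph G) : IsCircleGraph H := by
  obtain ⟨l, r, h⟩ := h
  refine ⟨fun v => l (f v), fun v => r (f v), fun v => h.lt _,
    fun a b hab => h.ne _ _ (f.injective.ne hab), fun a b hab => ?_⟩
  rw [← f.map_adj_iff]
  exact h.adj_iff _ _ (f.injective.ne hab)

/-- Reflecting the open interval between the ends of `v` toggles the crossing of two chords exactly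
when each has one end inside, that is, when both cross `v`. -/
theorem IsCircleGraph.localComplement {V : Type*} {G : SimpleGraph V} (h : IsCircleGraph G)
    (v : V) : IsCircleGraph (localComplement G v) := by
  obtain ⟨l, r, h⟩ := h
  have hv := h.lt v
  -- A chord with both ends inside the interval has its ends exchanged by the reflection, so the new
  -- left end comes from the old right end.
  refine ⟨fun a => if l v < l a ∧ l a < r v then
      (if r a < r v then l v + r v - r a else l v + r v - l a) else l a,
    fun a => if l v < r a ∧ r a < r v then
      (if l v < l a then l v + r v - l a else l v + r v - r a) else r a,
    fun a => ?_, fun a b hab => ?_, fun a b hab => ?_⟩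
  · have := h.lt a
    by_cases hav : a = v
    · subst hav; simpa
    · have := h.ne a v hav
      split_ifs <;> omega
  · have := h.ne a b hab
    have ha := h.lt a
    have hb := h.lt b
    have hav : a = v ∨ _ := (em _).imp_right (h.ne a v)
    have hbv : b = v ∨ _ := (em _).imp_right (h.ne b v)
    rcases hav with rfl | hav
    · simp only [lt_irrefl, false_and, and_false, if_false]
      split_ifs <;> omega
    rcases hbv with rfl | hbv
    · simp only [lt_irrefl, false_and, and_false, if_false]
      split_ifs <;> omega
    split_ifs <;> omega
  · have hne := h.ne a b hab
    have ha := h.lt a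
    have hb := h.lt b
    have hav : a = v ∨ _ := (em _).imp_right (fun h' => And.intro h' (h.ne a v h'))
    have hbv : b = v ∨ _ := (em _).imp_right (fun h' => And.intro h' (h.ne b v h'))
    change (a ≠ b ∧ Xor (G.Adj a b) (G.Adj v a ∧ G.Adj v b)) ↔ _
    simp only [ne_eq, hab, not_false_eq_true, true_and]
    rcases hav with rfl | ⟨hav', hav⟩
    · rw [h.adj_iff a b hab]
      simp only [SimpleGraph.irrefl, false_and, xor_def, or_false, not_false_eq_true, and_true]
      simp only [lt_irrefl, false_and, and_false, if_false]
      split_ifs <;> omega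
    rcases hbv with rfl | ⟨hbv', hbv⟩
    · rw [h.adj_iff a b hab]
      simp only [SimpleGraph.irrefl, false_and, xor_def, and_false, or_false, not_false_eq_true, and_true]
      simp only [lt_irrefl, false_and, and_false, if_false]
      split_ifs <;> omega
    rw [h.adj_iff a b hab, h.adj_iff v a (Ne.symm hav'), h.adj_iff v b (Ne.symm hbv'), xor_def]
    generalize l a = la at *
    generalize l b = lb at *
    generalize l v = lv at *
    generalize r a = ra at *
    generalize r b = rb at *
    generalize r v = rv at *
    clear h
    rcases lt_or_gt_of_ne hav.1 with h1 | h1 <;> rcases lt_or_gt_of_ne hav.2.1 with h2 | h2 <;>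
    rcases lt_or_gt_of_ne hav.2.2.1 with h3 | h3 <;>
    rcases lt_or_gt_of_ne hav.2.2.2 with h4 | h4 <;>
    omega

theorem ContainsVertexMinor.isCircleGraph.{u, v} {W : Type v} {H : SimpleGraph W} {V : Type u}
    {G : SimpleGraph V} (h : ContainsVertexMinor H G) (hG : IsCircleGraph G) :
    IsCircleGraph H := by
  induction h with
  | of_iso e => exact hG.comap e.symm.toEmbedding
  | delete v _ ih => exact ih (hG.comap (SimpleGraph.Embedding.induce _))
  | local_complement v _ ih => exact ih (hG.localComplement v)

/-! ### Three paths of length three do not fit into a chord diagram -/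

section Obstructions

variable {V : Type*} {l r : V → ℤ} {G : SimpleGraph V} {s t : V}

/-- The ends of `s` and `t` leave two arcs of the circle joining the two chords. The crossing of `a`
and `b` forces their free ends into the same arc: the gap between `r s` and `l t` in the first
alternative, the outer arc through infinity in the other three. -/
theorem IsChordDiagram.path_disjoint (h : IsChordDiagram l r G) (hl : l s < l t) (hr : r s < l t)
    {a b : V} (hsa : G.Adj s a) (hsb : ¬ G.Adj s b) (hta : ¬ G.Adj t a) (htb : G.Adj t b)
    (hab : G.Adj a b) (nsb : s ≠ b) (nta : t ≠ a) :
    (l s < l a ∧ l a < r s ∧ r s < l b ∧ l b < r a ∧ r a < l t ∧ l t < r b ∧ r b < r t) ∨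
    ((l a < l b ∧ l b < l s ∧ l s < r a ∧ r a < r s ∧ l t < r b ∧ r b < r t) ∨
      (l s < l a ∧ l a < r s ∧ l t < l b ∧ l b < r t ∧ r t < r a ∧ r a < r b) ∨
      (l b < l s ∧ l s < l a ∧ l a < r s ∧ l t < r b ∧ r b < r t ∧ r t < r a)) := by
  have h1 := (h.adj_iff s a hsa.ne).1 hsa
  have h2 := (h.adj_iff t b htb.ne).1 htb
  have h3 := (h.adj_iff a b hab.ne).1 hab
  have h4 := mt (h.adj_iff s b nsb).2 hsb
  have h5 := mt (h.adj_iff t a nta).2 hta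
  have n4 := h.ne s b nsb
  have n5 := h.ne t a nta
  have := h.lt s
  have := h.lt t
  rcases h1 with h1 | h1 <;> rcases h2 with h2 | h2 <;> rcases h3 with h3 | h3 <;> omega

/-- Again two arcs join the chords, now the gap to the left and the gap to the right of `t` inside
`s`; the alternatives say which of them contains an end of both `a` and `b`. -/
theorem IsChordDiagram.path_nested (h : IsChordDiagram l r G) (hl : l s < l t) (hr : r t < r s)
    {a b : V} (hsa : G.Adj s a) (hsb : ¬ G.Adj s b) (hta : ¬ G.Adj t a) (htb : G.Adj t b)
    (hab : G.Adj a b) (nsb : s ≠ b) (nta : t ≠ a) :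
    (l s < l b ∧ l t < r b ∧ r b < r t ∧
      ((l b < r a ∧ r a < l t ∧ l a < l s) ∨ (l b < l a ∧ l a < l t ∧ r s < r a))) ∨
    (l t < l b ∧ l b < r t ∧ r b < r s ∧
      ((r t < r a ∧ r a < r b ∧ l a < l s) ∨ (r t < l a ∧ l a < r b ∧ r s < r a))) := by
  have h1 := (h.adj_iff s a hsa.ne).1 hsa
  have h2 := (h.adj_iff t b htb.ne).1 htb
  have h3 := (h.adj_iff a b hab.ne).1 hab
  have h4 := mt (h.adj_iff s b nsb).2 hsb
  have h5 := mt (h.adj_iff t a nta).2 hta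
  have n4 := h.ne s b nsb
  have n5 := h.ne t a nta
  have := h.lt s
  have := h.lt t
  rcases h1 with h1 | h1 <;> rcases h2 with h2 | h2 <;> rcases h3 with h3 | h3 <;> omega

/-- The ends of two crossing chords cut the circle into four arcs. As `a` crosses only `s`, it cuts
off either the left or the right end of `s`; likewise `b` cuts off one end of `t`. The adjacency of
`a` and `b` plays no role yet. -/
theorem IsChordDiagram.path_crossing (h : IsChordDiagram l r G) (hl : l s < l t) (hm : l t < r s)
    (hr : r s < r t)
    {a b : V} (hsa : G.Adj s a) (hsb : ¬ G.Adj s b) (hta : ¬ G.Adj t a) (htb : G.Adj t b)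
    (nsb : s ≠ b) (nta : t ≠ a) :
    (((l a < l s ∧ l s < r a ∧ r a < l t) ∨ (l s < l a ∧ l a < l t ∧ r t < r a)) ∨
      (l t < l a ∧ l a < r s ∧ r s < r a ∧ r a < r t)) ∧
    ((l s < l b ∧ l b < l t ∧ l t < r b ∧ r b < r s) ∨
      (r s < l b ∧ l b < r t ∧ r t < r b) ∨ (l b < l s ∧ r s < r b ∧ r b < r t)) := by
  have h1 := (h.adj_iff s a hsa.ne).1 hsa
  have h2 := (h.adj_iff t b htb.ne).1 htb
  have h4 := mt (h.adj_iff s b nsb).2 hsb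
  have h5 := mt (h.adj_iff t a nta).2 hta
  have n4 := h.ne s b nsb
  have n5 := h.ne t a nta
  have := h.lt s
  have := h.lt t
  rcases h1 with h1 | h1 <;> rcases h2 with h2 | h2 <;> omega

theorem exists_pair_of_three {P Q : Fin 3 → Prop} (h : ∀ i, P i ∨ Q i) :
    ∃ i j, i ≠ j ∧ (P i ∧ P j ∨ Q i ∧ Q j) := by
  have h0 := h 0
  have h1 := h 1
  have h2 := h 2
  have n1 : (0 : Fin 3) ≠ 1 := by decide
  have n2 : (0 : Fin 3) ≠ 2 := by decide
  have n3 : (1 : Fin 3) ≠ 2 := by decide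
  by_cases P 0 <;> by_cases P 1
  · exact ⟨0, 1, n1, by tauto⟩
  · by_cases P 2
    · exact ⟨0, 2, n2, by tauto⟩
    · exact ⟨1, 2, n3, by tauto⟩
  · by_cases P 2
    · exact ⟨1, 2, n3, by tauto⟩
    · exact ⟨0, 2, n2, by tauto⟩
  · exact ⟨0, 1, n1, by tauto⟩

/-- Three paths `s`, `a i`, `b i`, `t` of length three between the vertices `s` and `t`, without
edges between different paths. -/
structure IsThreePaths (G : SimpleGraph V) (s t : V) (a b : Fin 3 → V) : Prop where
  source_adj : ∀ i, G.Adj s (a i)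
  source_not_adj : ∀ i, ¬ G.Adj s (b i)
  sink_not_adj : ∀ i, ¬ G.Adj t (a i)
  sink_adj : ∀ i, G.Adj t (b i)
  adj_iff : ∀ i j, G.Adj (a i) (b j) ↔ i = j
  not_adj : ∀ i j, ¬ G.Adj (a i) (a j)
  not_adj' : ∀ i j, ¬ G.Adj (b i) (b j)
  ne : s ≠ t
  source_ne : ∀ i, s ≠ b i
  sink_ne : ∀ i, t ≠ a i

theorem IsThreePaths.symm {a b : Fin 3 → V} (h : IsThreePaths G s t a b) :
    IsThreePaths G t s b a where
  source_adj := h.sink_adj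
  source_not_adj := h.sink_not_adj
  sink_not_adj := h.source_not_adj
  sink_adj := h.source_adj
  adj_iff i j := by rw [G.adj_comm, h.adj_iff, eq_comm]
  not_adj := h.not_adj'
  not_adj' := h.not_adj
  ne := h.ne.symm
  source_ne := h.sink_ne
  sink_ne := h.source_ne

/-- Whether `s` and `t` are adjacent is left open, so all relative positions of their chords occur:
disjoint, crossing, nested. In each, two of the three paths go the same way, which is impossible. -/
theorem IsThreePaths.false_of_lt {a b : Fin 3 → V} (h : IsThreePaths G s t a b)
    (hd : IsChordDiagram l r G) (hl : l s < l t) : False := by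
  have naa : ∀ i j, i ≠ j → a i ≠ a j := fun i j hij he =>
    hij ((h.adj_iff i j).1 (he ▸ (h.adj_iff j j).2 rfl))
  have nab : ∀ i j, a i ≠ b j := fun i j he => h.source_not_adj j (he ▸ h.source_adj i)
  have faa : ∀ i j, i ≠ j → _ := fun i j hij =>
    And.intro (hd.ne _ _ (naa i j hij)) (mt (hd.adj_iff _ _ (naa i j hij)).2 (h.not_adj i j))
  have fab : ∀ i j, i ≠ j → _ := fun i j hij =>
    And.intro (hd.ne _ _ (nab i j)) (mt (hd.adj_iff _ _ (nab i j)).2 (mt (h.adj_iff i j).1 hij))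
  have xab : ∀ i, _ := fun i => (hd.adj_iff _ _ (nab i i)).1 ((h.adj_iff i i).2 rfl)
  have hst := hd.ne s t h.ne
  have hs := hd.lt s
  have ht := hd.lt t
  rcases lt_or_gt_of_ne hst.2.2.1 with h1 | h1
  · obtain ⟨i, j, hij, hP⟩ := exists_pair_of_three fun i => hd.path_disjoint hl h1
      (h.source_adj i) (h.source_not_adj i) (h.sink_not_adj i) (h.sink_adj i)
      ((h.adj_iff i i).2 rfl) (h.source_ne i) (h.sink_ne i)
    have h2 := faa i j hij
    have h3 := fab i j hij
    have h4 := fab j i hij.symm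
    rcases hP with ⟨h5, h6⟩ | ⟨h5, h6⟩
    -- In the common gap `a i` reaches past the end of `b i` but not to that of `b j`, and vice
    -- versa: `r (a i) < l (b j) < r (a j) < l (b i) < r (a i)`.
    · omega
    · rcases h5 with h5 | h5 | h5 <;> rcases h6 with h6 | h6 | h6 <;> omega
  rcases lt_or_gt_of_ne hst.2.2.2 with h2 | h2
  -- The pigeonhole is applied to the end of `s` that `a i` cuts off. Two such chords are nested
  -- around this end, and the `b` meeting the inner one also meets `t`, so it would have to cross
  -- the outer one as well.
  · obtain ⟨i, j, hij, hP⟩ := exists_pair_of_three fun i =>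
      or_and_right.1 (hd.path_crossing hl h1 h2 (h.source_adj i)
      (h.source_not_adj i) (h.sink_not_adj i) (h.sink_adj i) (h.source_ne i) (h.sink_ne i))
    have h3 := faa i j hij
    have h4 := fab i j hij
    have h5 := fab j i hij.symm
    have h6 := xab i
    have h7 := xab j
    rcases hP with ⟨⟨h8, h9⟩, h10, h11⟩ | ⟨⟨h8, h9⟩, h10, h11⟩
    · rcases h8 with h8 | h8 <;> rcases h9 with h9 | h9 | h9 <;> rcases h10 with h10 | h10 <;>
        rcases h11 with h11 | h11 | h11 <;> omega
    · rcases h9 with h9 | h9 | h9 <;> rcases h11 with h11 | h11 | h11 <;> omega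
  · obtain ⟨i, j, hij, hP⟩ := exists_pair_of_three fun i => hd.path_nested hl h2
      (h.source_adj i) (h.source_not_adj i) (h.sink_not_adj i) (h.sink_adj i)
      ((h.adj_iff i i).2 rfl) (h.source_ne i) (h.sink_ne i)
    have h2 := faa i j hij
    have h3 := fab i j hij
    have h4 := fab j i hij.symm
    rcases hP with ⟨h5, h6⟩ | ⟨h5, h6⟩
    · omega
    · omega

theorem IsThreePaths.not_isCircleGraph {a b : Fin 3 → V} (h : IsThreePaths G s t a b) :
    ¬ IsCircleGraph G := by
  rintro ⟨l, r, hd⟩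
  rcases lt_or_gt_of_ne (hd.ne s t h.ne).1 with hl | hl
  · exact h.false_of_lt hd hl
  · exact h.symm.false_of_lt hd hl

end Obstructions

/-! ### Adjacency in melon graphs -/

section MelonAdj

variable {m : ℕ} {ℓ : Fin m → ℕ}

theorem melonPathVertex_eq_source {i : Fin m} {j : ℕ} :
    melonPathVertex ℓ i j = .source ↔ j = 0 := by
  unfold melonPathVertex
  split_ifs <;> simp [*]

theorem melonPathVertex_eq_sink {i : Fin m} {j : ℕ} :
    melonPathVertex ℓ i j = .sink ↔ ℓ i ≤ j ∧ j ≠ 0 := by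
  unfold melonPathVertex
  split_ifs with h1 h2 <;> simp [*]
  omega

theorem melonPathVertex_eq_inner {i i' : Fin m} {j : ℕ} {j' : Fin (ℓ i' - 1)} :
    melonPathVertex ℓ i j = .inner i' j' ↔ i = i' ∧ j = j' + 1 := by
  unfold melonPathVertex
  have := j'.2
  split_ifs with h1 h2
  · simp; omega
  · constructor
    · intro h
      injection h with h h'
      subst h
      have := eq_of_heq h'
      rw [← this]
      exact ⟨rfl, by simp; omega⟩
    · rintro ⟨rfl, h⟩
      congr
      omega
  · simp; rintro rfl; omega

theorem melonGraph_adj_source_sink :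
    (melonGraph ℓ).Adj .source .sink ↔ ∃ i, ℓ i = 1 := by
  simp only [melonGraph, SimpleGraph.fromRel_adj, @eq_comm _ MelonVertex.source,
    @eq_comm _ MelonVertex.sink, melonPathVertex_eq_source, melonPathVertex_eq_sink]
  constructor
  · rintro ⟨-, ⟨i, j, hj, h⟩ | ⟨i, j, hj, h⟩⟩
    · exact ⟨i, by omega⟩
    · omega
  · rintro ⟨i, hi⟩
    exact ⟨by simp, Or.inl ⟨i, 0, by omega, rfl, by omega, by omega⟩⟩

theorem melonGraph_adj_source_inner (i : Fin m) (j : Fin (ℓ i - 1)) :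
    (melonGraph ℓ).Adj .source (.inner i j) ↔ j.1 = 0 := by
  simp only [melonGraph, SimpleGraph.fromRel_adj, @eq_comm _ MelonVertex.source,
    @eq_comm _ (MelonVertex.inner _ _), melonPathVertex_eq_source, melonPathVertex_eq_inner]
  constructor
  · rintro ⟨-, ⟨i, j, hj, h⟩ | ⟨i, j, hj, h⟩⟩ <;> omega
  · intro h
    exact ⟨by simp, Or.inl ⟨i, 0, by omega, rfl, rfl, by omega⟩⟩

theorem melonGraph_adj_sink_inner (i : Fin m) (j : Fin (ℓ i - 1)) :
    (melonGraph ℓ).Adj .sink (.inner i j) ↔ j.1 + 2 = ℓ i := by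
  simp only [melonGraph, SimpleGraph.fromRel_adj, @eq_comm _ MelonVertex.sink,
    @eq_comm _ (MelonVertex.inner _ _), melonPathVertex_eq_sink, melonPathVertex_eq_inner]
  constructor
  · rintro ⟨-, ⟨i, j, hj, h⟩ | ⟨i, j, hj, ⟨rfl, h⟩, h'⟩⟩ <;> omega
  · intro h
    exact ⟨by simp, Or.inr ⟨i, j + 1, by omega, ⟨rfl, by omega⟩, by omega, by omega⟩⟩

theorem melonGraph_adj_inner_inner (i : Fin m) (j : Fin (ℓ i - 1)) (i' : Fin m)
    (j' : Fin (ℓ i' - 1)) : (melonGraph ℓ).Adj (.inner i j) (.inner i' j') ↔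
      i = i' ∧ (j.1 + 1 = j'.1 ∨ j'.1 + 1 = j.1) := by
  simp only [melonGraph, SimpleGraph.fromRel_adj,
    @eq_comm _ (MelonVertex.inner _ _) (melonPathVertex _ _ _), melonPathVertex_eq_inner]
  constructor
  · rintro ⟨-, ⟨i, j, hj, ⟨rfl, h⟩, rfl, h'⟩ | ⟨i, j, hj, ⟨rfl, h⟩, rfl, h'⟩⟩ <;>
      exact ⟨rfl, by omega⟩
  · rintro ⟨rfl, h⟩
    refine ⟨fun h' => ?_, ?_⟩
    · injection h' with _ h'
      rw [h'] at h
      omega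
    · rcases h with h | h
      · exact Or.inl ⟨i, j + 1, by omega, ⟨rfl, rfl⟩, rfl, by omega⟩
      · exact Or.inr ⟨i, j' + 1, by omega, ⟨rfl, rfl⟩, rfl, by omega⟩

theorem MelonVertex.inner_inj {i i' : Fin m} {j : Fin (ℓ i - 1)} {j' : Fin (ℓ i' - 1)} :
    (MelonVertex.inner i j : MelonVertex ℓ) = .inner i' j' ↔ i = i' ∧ j.1 = j'.1 := by
  constructor
  · intro h
    injection h with h h'
    subst h
    exact ⟨rfl, by rw [eq_of_heq h']⟩
  · rintro ⟨rfl, h⟩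
    rw [Fin.ext h]

instance MelonVertex.finite : Finite (MelonVertex ℓ) :=
  Finite.of_surjective (fun x : Option (Option (Σ i : Fin m, Fin (ℓ i - 1))) => match x with
    | none => (.source : MelonVertex ℓ)
    | some none => .sink
    | some (some y) => .inner y.1 y.2) fun x => by
      cases x with
      | source => exact ⟨none, rfl⟩
      | sink => exact ⟨some none, rfl⟩
      | inner i j => exact ⟨some (some ⟨i, j⟩), rfl⟩

end MelonAdj

/-! ### Vertex-minors under isomorphisms and induced embeddings -/

section VertexMinor

theorem localComplement_adj {V : Type*} (G : SimpleGraph V) (v a b : V) :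
    (localComplement G v).Adj a b ↔ a ≠ b ∧ Xor (G.Adj a b) (G.Adj v a ∧ G.Adj v b) := Iff.rfl

theorem ContainsVertexMinor.congr.{u, u', v} {W : Type v} {H : SimpleGraph W} {V : Type u}
    {G : SimpleGraph V} (h : ContainsVertexMinor H G) {V' : Type u'} {G' : SimpleGraph V'}
    (e : G' ≃g G) : ContainsVertexMinor H G' := by
  induction h generalizing V' with
  | of_iso e' => exact .of_iso (e.trans e')
  | @delete V G v h ih =>
    refine .delete (e.symm v) (ih ⟨e.toEquiv.subtypeEquiv fun a => ?_, ?_⟩)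
    · simp [RelIso.eq_symm_apply]
    · intro a b
      exact e.map_adj_iff
  | local_complement v h ih =>
    refine .local_complement (e.symm v) (ih ⟨e.toEquiv, fun {a b} => ?_⟩)
    have h1 : ∀ a, (G'.Adj (e.symm v) a ↔ _) := fun a => (e.map_adj_iff (v := e.symm v)).symm
    simp only [localComplement_adj, h1, RelIso.apply_symm_apply]
    simp [e.map_adj_iff]

/-- A vertex-minor of an induced subgraph is a vertex-minor. -/
theorem ContainsVertexMinor.of_embedding.{u, u', v} {W : Type v} {H : SimpleGraph W} {V : Type u}
    {G : SimpleGraph V} (h : ContainsVertexMinor H G) {V' : Type u'} [Finite V']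
    {G' : SimpleGraph V'} (f : G ↪g G') : ContainsVertexMinor H G' := by
  induction hn : Nat.card V' generalizing V' with
  | zero =>
    have := Finite.card_eq_zero_iff.1 hn
    exact h.congr (RelIso.ofSurjective f fun v => isEmptyElim v).symm
  | succ n ih =>
    by_cases hf : Function.Surjective f
    · exact h.congr (RelIso.ofSurjective f hf).symm
    · simp only [Function.Surjective, not_forall, not_exists] at hf
      obtain ⟨v, hv⟩ := hf
      -- A vertex outside the image of `f` is deleted, and `f` still embeds into what remains.
      refine .delete v (ih (V' := ({v}ᶜ : Set V'))
        ⟨⟨fun a => ⟨f a, hv a⟩, fun a b hab => ?_⟩, f.map_rel_iff⟩ ?_)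
      · exact f.injective (congrArg Subtype.val hab)
      · have := Set.ncard_compl ({v} : Set V')
        rw [Set.ncard_singleton, hn] at this
        simpa using this

end VertexMinor

/-! ### Reduction of three long paths to the two obstructions -/

section LongPaths

variable {m : ℕ} {ℓ : Fin m → ℕ}

/-- Local complementation at the last inner vertex of a path, followed by the deletion of this
vertex, shortens the path. -/
theorem ContainsVertexMinor.of_shorter.{v} {W : Type v} {H : SimpleGraph W} {ℓ' : Fin m → ℕ}
    {i₀ : Fin m} (h2 : 2 ≤ ℓ' i₀) (h₀ : ℓ i₀ = ℓ' i₀ + 1) (hne : ∀ i, i ≠ i₀ → ℓ i = ℓ' i)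
    (h : ContainsVertexMinor H (melonGraph ℓ')) : ContainsVertexMinor H (melonGraph ℓ) := by
  have hle : ∀ i, ℓ' i ≤ ℓ i := fun i => by
    by_cases hi : i = i₀
    · subst hi; omega
    · exact (hne i hi).ge
  let f : MelonVertex ℓ' → MelonVertex ℓ
    | .source => .source
    | .sink => .sink
    | .inner i j => .inner i ⟨j, by have := hle i; omega⟩
  have hf : Function.Injective f := by
    rintro (_ | _ | ⟨i, j⟩) (_ | _ | ⟨i', j'⟩) <;> simp only [f, reduceCtorEq, imp_self]
    rw [MelonVertex.inner_inj, MelonVertex.inner_inj]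
    exact id
  -- Index `ℓ i₀ - 2` is the last inner vertex. Since `2 ≤ ℓ' i₀`, its two neighbours are `sink` and
  -- another inner vertex, which are not adjacent; the local complementation joins them.
  refine .local_complement (.inner i₀ ⟨ℓ i₀ - 2, by omega⟩) (h.of_embedding ⟨⟨f, hf⟩, ?_⟩)
  intro x y
  change (localComplement _ _).Adj (f x) (f y) ↔ _
  rw [localComplement_adj, hf.ne_iff]
  have hsource : ¬ (melonGraph ℓ).Adj (.inner i₀ ⟨ℓ i₀ - 2, by omega⟩) .source := by
    rw [SimpleGraph.adj_comm, melonGraph_adj_source_inner]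
    simp only; omega
  have hsink : (melonGraph ℓ).Adj (.inner i₀ ⟨ℓ i₀ - 2, by omega⟩) .sink := by
    rw [SimpleGraph.adj_comm, melonGraph_adj_sink_inner]
    simp only; omega
  have hinner : ∀ i (j : Fin (ℓ' i - 1)), (melonGraph ℓ).Adj (.inner i₀ ⟨ℓ i₀ - 2, by omega⟩)
      (f (.inner i j)) ↔ i = i₀ ∧ j.1 + 2 = ℓ' i := by
    intro i j
    simp only [f, melonGraph_adj_inner_inner]
    have := j.2
    constructor
    · rintro ⟨rfl, h⟩; omega
    · rintro ⟨rfl, h⟩; exact ⟨rfl, by omega⟩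
  have hsi : ∀ i (j : Fin (ℓ' i - 1)), (Xor ((melonGraph ℓ).Adj .sink (f (.inner i j)))
      (i = i₀ ∧ j.1 + 2 = ℓ' i)) ↔ (melonGraph ℓ').Adj .sink (.inner i j) := by
    intro i j
    simp only [f, melonGraph_adj_sink_inner]
    have := j.2
    by_cases hi : i = i₀
    · subst hi
      simp [xor_def]; omega
    · simp [xor_def, hi, hne i hi]
  have hss : (∃ i, ℓ i = 1) ↔ ∃ i, ℓ' i = 1 := by
    refine exists_congr fun i => ?_
    by_cases hi : i = i₀
    · subst hi; omega
    · rw [hne i hi]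
  rcases x with _ | _ | ⟨i, j⟩ <;> rcases y with _ | _ | ⟨i', j'⟩
  · simp
  · simp only [f, hsource, false_and, xor_def]
    simpa [melonGraph_adj_source_sink] using hss
  · simp only [f, hsource, false_and, xor_def]
    simp [melonGraph_adj_source_inner]
  · simp only [f, hsource, and_false, xor_def]
    rw [SimpleGraph.adj_comm, (melonGraph ℓ').adj_comm]
    simpa [melonGraph_adj_source_sink] using hss
  · simp
  · simp only [hinner, show f .sink = .sink from rfl, hsink, true_and, hsi]
    simp
  · simp only [f, hsource, and_false, xor_def]
    rw [SimpleGraph.adj_comm, (melonGraph ℓ').adj_comm]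
    simp [melonGraph_adj_source_inner]
  · rw [SimpleGraph.adj_comm, (melonGraph ℓ').adj_comm]
    simp only [hinner, show f .sink = .sink from rfl, hsink, and_true, hsi]
    simp
  · rw [hinner, hinner]
    simp only [f, melonGraph_adj_inner_inner, ne_eq, MelonVertex.inner_inj, xor_def]
    constructor
    -- Only one surviving inner vertex is a neighbour of the removed one, so no pair of inner
    -- vertices is toggled.
    · rintro ⟨h1, ⟨h2, h3⟩ | ⟨⟨h2, h3⟩, h4⟩⟩
      · exact h2
      · exact absurd ⟨h2.1.trans h3.1.symm, by
          obtain ⟨⟨rfl, h5⟩, rfl, h6⟩ := And.intro h2 h3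
          omega⟩ h1
    · rintro ⟨rfl, h⟩
      exact ⟨by omega, Or.inl ⟨⟨rfl, h⟩, by omega⟩⟩

/-- Induction on the total excess length, shortening one path by one edge at a time. Target length
one is excluded for a shortened path because the shortening needs a remaining inner vertex. -/
theorem ContainsVertexMinor.of_le.{v} {W : Type v} {H : SimpleGraph W} {ℓ' : Fin m → ℕ}
    (hle : ∀ i, ℓ' i ≤ ℓ i) (h2 : ∀ i, ℓ' i ≠ ℓ i → 2 ≤ ℓ' i)
    (h : ContainsVertexMinor H (melonGraph ℓ')) : ContainsVertexMinor H (melonGraph ℓ) := by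
  induction hn : ∑ i, (ℓ i - ℓ' i) generalizing ℓ with
  | zero =>
    have : ℓ = ℓ' := funext fun i => by
      have := Finset.sum_eq_zero_iff.1 hn i (Finset.mem_univ i)
      have := hle i
      omega
    rwa [this]
  | succ n ih =>
    obtain ⟨i₀, -, hi₀⟩ := Finset.exists_ne_zero_of_sum_ne_zero (hn.trans_ne n.succ_ne_zero)
    have h3 := h2 i₀ (by omega)
    refine ContainsVertexMinor.of_shorter (ℓ' := Function.update ℓ i₀ (ℓ i₀ - 1)) (i₀ := i₀)
      (by simp; omega) (by simp; omega) (fun i hi => by simp [hi]) (ih (fun i => ?_) (fun i => ?_) ?_)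
    · by_cases hi : i = i₀
      · subst hi; simp; omega
      · simpa [hi] using hle i
    · by_cases hi : i = i₀
      · subst hi; intro; exact h3
      · simpa [hi] using h2 i
    · rw [← Finset.add_sum_erase _ _ (Finset.mem_univ i₀)] at hn ⊢
      rw [Function.update_self]
      have : ∀ i ∈ Finset.univ.erase i₀, Function.update ℓ i₀ (ℓ i₀ - 1) i - ℓ' i = ℓ i - ℓ' i :=
        fun i hi => by rw [Function.update_of_ne (Finset.ne_of_mem_erase hi)]
      rw [Finset.sum_congr rfl this]
      omega

/-- A choice of some of the paths, including the path of length one if there is one, induces a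
melon graph. -/
theorem ContainsVertexMinor.of_comp.{v} {W : Type v} {H : SimpleGraph W} {m' : ℕ}
    (g : Fin m' ↪ Fin m) (hg : ∀ i, ℓ i = 1 → ∃ j, g j = i)
    (h : ContainsVertexMinor H (melonGraph fun j => ℓ (g j))) :
    ContainsVertexMinor H (melonGraph ℓ) := by
  let f : MelonVertex (fun j => ℓ (g j)) → MelonVertex ℓ
    | .source => .source
    | .sink => .sink
    | .inner i j => .inner (g i) j
  have hf : Function.Injective f := by
    rintro (_ | _ | ⟨i, j⟩) (_ | _ | ⟨i', j'⟩) <;> simp only [f, reduceCtorEq, imp_self]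
    rw [MelonVertex.inner_inj, MelonVertex.inner_inj, g.injective.eq_iff]
    exact id
  refine h.of_embedding ⟨⟨f, hf⟩, ?_⟩
  have hss : (∃ i, ℓ i = 1) ↔ ∃ i, ℓ (g i) = 1 := by
    constructor
    · rintro ⟨i, hi⟩
      obtain ⟨j, rfl⟩ := hg i hi
      exact ⟨j, hi⟩
    · rintro ⟨j, hj⟩
      exact ⟨g j, hj⟩
  intro x y
  change (melonGraph ℓ).Adj (f x) (f y) ↔ _
  rcases x with _ | _ | ⟨i, j⟩ <;> rcases y with _ | _ | ⟨i', j'⟩ <;> simp only [f]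
  · simp
  · simpa [melonGraph_adj_source_sink] using hss
  · simp [melonGraph_adj_source_inner]
  · rw [SimpleGraph.adj_comm, SimpleGraph.adj_comm _ _ MelonVertex.source]
    simpa [melonGraph_adj_source_sink] using hss
  · simp
  · simp [melonGraph_adj_sink_inner]
  · rw [SimpleGraph.adj_comm, SimpleGraph.adj_comm _ _ MelonVertex.source]
    simp [melonGraph_adj_source_inner]
  · rw [SimpleGraph.adj_comm, SimpleGraph.adj_comm _ _ MelonVertex.sink]
    simp [melonGraph_adj_sink_inner]
  · simp [melonGraph_adj_inner_inner]

/-- An edge between the endpoints survives the deletion of inner vertices, so a path of length one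
has to be kept along with the three long ones. -/
theorem melonGraph_containsVertexMinor (hℓ : ∀ i j, ℓ i = 1 → ℓ j = 1 → i = j)
    (g : Fin 3 ↪ Fin m) (hg : ∀ j, 3 ≤ ℓ (g j)) :
    ContainsVertexMinor graphM3 (melonGraph ℓ) ∨
      ContainsVertexMinor (bookGraph 3) (melonGraph ℓ) := by
  by_cases h1 : ∃ i, ℓ i = 1
  · obtain ⟨i₁, h1⟩ := h1
    right
    let g' : Fin 4 ↪ Fin m := ⟨Fin.cons i₁ g, Fin.cons_injective_iff.2 ⟨by
      rintro ⟨j, hj⟩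
      have := hg j
      rw [hj] at this
      omega, g.injective⟩⟩
    refine ContainsVertexMinor.of_comp g' (fun i hi => ⟨0, hℓ _ _ h1 hi⟩) ?_
    refine ContainsVertexMinor.of_le (ℓ' := Fin.cons 1 fun _ => 3) ?_ ?_
      (.of_iso SimpleGraph.Iso.refl)
    · intro i
      refine Fin.cases ?_ (fun j => ?_) i
      · exact h1.ge
      · exact hg j
    · intro i
      refine Fin.cases ?_ (fun j => ?_) i
      · exact fun h => absurd h1.symm h
      · exact fun _ => by simp
  · left
    refine ContainsVertexMinor.of_comp g (fun i hi => absurd ⟨i, hi⟩ h1) ?_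
    exact ContainsVertexMinor.of_le (ℓ' := fun _ => 3) hg (fun _ _ => by simp)
      (.of_iso SimpleGraph.Iso.refl)

end LongPaths

theorem isThreePaths_melonGraph {m : ℕ} {ℓ : Fin m → ℕ} (g : Fin 3 ↪ Fin m)
    (hg : ∀ i, ℓ (g i) = 3) : IsThreePaths (melonGraph ℓ) .source .sink
      (fun i => .inner (g i) ⟨0, by rw [hg]; decide⟩)
      (fun i => .inner (g i) ⟨1, by rw [hg]; decide⟩) where
  source_adj i := by simp [melonGraph_adj_source_inner]
  source_not_adj i := by simp [melonGraph_adj_source_inner]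
  sink_not_adj i := by simp [melonGraph_adj_sink_inner, hg]
  sink_adj i := by simp [melonGraph_adj_sink_inner, hg]
  adj_iff i j := by simp [melonGraph_adj_inner_inner]
  not_adj i j := by simp [melonGraph_adj_inner_inner]
  not_adj' i j := by simp [melonGraph_adj_inner_inner]
  ne := by simp
  source_ne i := by simp
  sink_ne i := by simp

theorem not_isCircleGraph_graphM3 : ¬ IsCircleGraph graphM3 :=
  (isThreePaths_melonGraph (Function.Embedding.refl _) fun _ => rfl).not_isCircleGraph

theorem not_isCircleGraph_bookGraph : ¬ IsCircleGraph (bookGraph 3) :=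
  (isThreePaths_melonGraph (Fin.succEmb 3) fun _ => rfl).not_isCircleGraph

/-! ### Chord diagrams for at most two long paths -/

section CircleMelon

variable {m : ℕ} {ℓ : Fin m → ℕ}

/-- Left ends of the chords of a melon graph with at most one long path on either side `e i`. -/
def melonChordLeft (d : Prop) [Decidable d] (e : Fin m → Bool) (P : Bool → ℕ) :
    MelonVertex ℓ → ℤ
  | .source => if d then 2 * P true - 1 else 2
  | .sink => if d then 2 else 2 * P true - 1
  | .inner i j =>
    if ℓ i < 3 then -1 - i
    else if e i then (if d then 2 * P true - 3 - 2 * j else 2 * j + 1)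
    else 2 * P true + m + 2 * P false - 2 - 2 * j

/-- Right ends of the chords of a melon graph with at most one long path on either side `e i`. -/
def melonChordRight (d : Prop) [Decidable d] (e : Fin m → Bool) (P : Bool → ℕ) :
    MelonVertex ℓ → ℤ
  | .source => 2 * P true + m + 2 * P false
  | .sink => 2 * P true + m + 3
  | .inner i j =>
    if ℓ i < 3 then 2 * P true + 1 + i
    else if e i then (if d then 2 * P true - 2 * j else 2 * j + 4)
    else 2 * P true + m + 2 * P false + 1 - 2 * j

/-- Write `P`, `Q` for `P true`, `P false`. The chords of the endpoints have left ends at `2` and `2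
* P - 1` and right ends at `2 * P + m + 3` and `2 * P + m + 2 * Q`; they are nested, or crossing if
the endpoints are adjacent. The long path on side `true` is a chain of short chords, consecutive
ones crossing, that runs from one left end to the other within `1, …, 2 * P`; the one on side
`false` does the same at the right ends, beyond `2 * P + m + 1`. The midpoints of paths of length
two are concentric chords enclosing both left ends, with right ends in the free stretch `2 * P + 1,
…, 2 * P + m`. -/
theorem isChordDiagram_melonGraph (e : Fin m → Bool) (P : Bool → ℕ) (hℓ : ∀ i, 1 ≤ ℓ i)
    (hP : ∀ b, 3 ≤ P b) (hPℓ : ∀ i, 3 ≤ ℓ i → ℓ i = P (e i))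
    (he : ∀ i j, 3 ≤ ℓ i → 3 ≤ ℓ j → e i = e j → i = j) [Decidable (∃ i, ℓ i = 1)] :
    IsChordDiagram (melonChordLeft (∃ i, ℓ i = 1) e P) (melonChordRight (∃ i, ℓ i = 1) e P)
      (melonGraph ℓ) := by
  have ht := hP true
  have hf := hP false
  set L := melonChordLeft (ℓ := ℓ) (∃ i, ℓ i = 1) e P with hL
  set R := melonChordRight (ℓ := ℓ) (∃ i, ℓ i = 1) e P with hR
  have rs : R .source = 2 * P true + m + 2 * P false := rfl
  have rt : R .sink = 2 * P true + m + 3 := rfl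
  have hshort : ∀ i j, ℓ i < 3 → L (.inner i j) = -1 - i ∧ R (.inner i j) = 2 * P true + 1 + i :=
    fun i j h => by simp [L, R, melonChordLeft, melonChordRight, h]
  have hdown : ∀ i j, 3 ≤ ℓ i → e i = false →
      L (.inner i j) = 2 * P true + m + 2 * P false - 2 - 2 * j ∧
        R (.inner i j) = 2 * P true + m + 2 * P false + 1 - 2 * j :=
    fun i j h h' => by simp [L, R, melonChordLeft, melonChordRight, h.not_gt, h']
  -- Making the endpoints adjacent exchanges the left ends of source and sink, so the chain at the
  -- left ends is run through backwards.
  have hup : (∃ i, ℓ i = 1) ∧ L .source = 2 * P true - 1 ∧ L .sink = 2 ∧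
        (∀ i j, 3 ≤ ℓ i → e i = true →
          L (.inner i j) = 2 * P true - 3 - 2 * j ∧ R (.inner i j) = 2 * P true - 2 * j) ∨
      ¬ (∃ i, ℓ i = 1) ∧ L .source = 2 ∧ L .sink = 2 * P true - 1 ∧
        (∀ i j, 3 ≤ ℓ i → e i = true →
          L (.inner i j) = 2 * j + 1 ∧ R (.inner i j) = 2 * j + 4) := by
    by_cases hd : ∃ i, ℓ i = 1
    · refine Or.inl ⟨hd, by simp [L, melonChordLeft, hd], by simp [L, melonChordLeft, hd],
        fun i j h h' => ?_⟩
      simp [L, R, melonChordLeft, melonChordRight, hd, h.not_gt, h']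
    · refine Or.inr ⟨hd, by simp [L, melonChordLeft, hd], by simp [L, melonChordLeft, hd],
        fun i j h h' => ?_⟩
      simp [L, R, melonChordLeft, melonChordRight, hd, h.not_gt, h']
  clear_value L R
  clear hL hR
  have hcase : ∀ i (j : Fin (ℓ i - 1)), (ℓ i < 3 ∧ L (.inner i j) = -1 - i ∧
        R (.inner i j) = 2 * P true + 1 + i) ∨ (3 ≤ ℓ i ∧ e i = true ∧ ℓ i = P true) ∨
      (3 ≤ ℓ i ∧ e i = false ∧ ℓ i = P false ∧
        L (.inner i j) = 2 * P true + m + 2 * P false - 2 - 2 * j ∧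
        R (.inner i j) = 2 * P true + m + 2 * P false + 1 - 2 * j) := fun i j => by
    rcases lt_or_ge (ℓ i) 3 with h | h
    · exact Or.inl ⟨h, hshort i j h⟩
    · have h1 := hPℓ i h
      cases hi : e i <;> rw [hi] at h1
      · exact Or.inr (Or.inr ⟨h, rfl, h1, hdown i j h hi⟩)
      · exact Or.inr (Or.inl ⟨h, rfl, h1⟩)
  have key : (∀ x, L x < R x) ∧ ∀ x y : MelonVertex ℓ, x ≠ y →
      (L x ≠ L y ∧ L x ≠ R y ∧ R x ≠ L y ∧ R x ≠ R y) ∧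
      ((melonGraph ℓ).Adj x y ↔
        (L x < L y ∧ L y < R x ∧ R x < R y) ∨ (L y < L x ∧ L x < R y ∧ R y < R x)) := by
    have hss := melonGraph_adj_source_sink (ℓ := ℓ)
    have hsi := melonGraph_adj_source_inner (ℓ := ℓ)
    have hti := melonGraph_adj_sink_inner (ℓ := ℓ)
    have comm := (melonGraph ℓ).adj_comm
    rcases hup with ⟨hd, ls, lt, hup⟩ | ⟨hd, ls, lt, hup⟩
    all_goals
      simp only [hd, iff_true, iff_false] at hss
      have hsource : ∀ i j, L .source ≠ L (.inner i j) ∧ L .source ≠ R (.inner i j) ∧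
          R .source ≠ L (.inner i j) ∧ R .source ≠ R (.inner i j) ∧ (j.1 = 0 ↔
        (L .source < L (.inner i j) ∧ L (.inner i j) < R .source ∧ R .source < R (.inner i j)) ∨
        (L (.inner i j) < L .source ∧ L .source < R (.inner i j) ∧
          R (.inner i j) < R .source)) := by
        intro i j
        have := j.2
        have := i.2
        rcases hcase i j with h1 | ⟨h1, h2, h3⟩ | h1
        · omega
        · have := hup i j h1 h2
          omega
        · omega
      have hsink : ∀ i j, L .sink ≠ L (.inner i j) ∧ L .sink ≠ R (.inner i j) ∧
          R .sink ≠ L (.inner i j) ∧ R .sink ≠ R (.inner i j) ∧ (j.1 + 2 = ℓ i ↔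
        (L .sink < L (.inner i j) ∧ L (.inner i j) < R .sink ∧ R .sink < R (.inner i j)) ∨
        (L (.inner i j) < L .sink ∧ L .sink < R (.inner i j) ∧
          R (.inner i j) < R .sink)) := by
        intro i j
        have := j.2
        have := i.2
        rcases hcase i j with h1 | ⟨h1, h2, h3⟩ | h1
        · have := hℓ i
          omega
        · have := hup i j h1 h2
          omega
        · omega
      constructor
      · rintro (_ | _ | ⟨i, j⟩)
        · omega
        · omega
        · have := j.2
          rcases hcase i j with h1 | ⟨h1, h2, h3⟩ | h1
          · omega
          · have := hup i j h1 h2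
            omega
          · omega
      · rintro (_ | _ | ⟨i, j⟩) (_ | _ | ⟨i', j'⟩) hxy
        · exact absurd rfl hxy
        · simp only [hss, true_iff, false_iff]
          omega
        · rw [hsi]
          have := hsource i' j'
          omega
        · simp only [comm _ MelonVertex.source, hss, true_iff, false_iff]
          omega
        · exact absurd rfl hxy
        · rw [hti]
          have := hsink i' j'
          omega
        · rw [comm, hsi]
          have := hsource i j
          omega
        · rw [comm, hti]
          have := hsink i j
          omega
        · rw [melonGraph_adj_inner_inner]
          rw [Ne, MelonVertex.inner_inj] at hxy
          have := j.2
          have := j'.2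
          have hi := i.2
          have hi' := i'.2
          by_cases hii : i = i'
          · subst hii
            simp only [true_and] at hxy ⊢
            rcases hcase i j with h1 | ⟨h1, h2, h3⟩ | h1
            · omega
            · have := hup i j h1 h2
              have := hup i j' h1 h2
              omega
            · rcases hcase i j' with h1' | ⟨h1', h2', h3'⟩ | h1'
              · omega
              · simp [h1.2.1] at h2'
              · omega
          · have hii' : i.1 ≠ i'.1 := fun h' => hii (Fin.ext h')
            simp only [hii, false_and, false_iff]
            rcases hcase i j with h1 | ⟨h1, h2, h3⟩ | h1 <;>
              rcases hcase i' j' with h1' | ⟨h1', h2', h3'⟩ | h1'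
            · omega
            · have := hup i' j' h1' h2'
              omega
            · omega
            · have := hup i j h1 h2
              omega
            · exact absurd (he i i' h1 h1' (h2.trans h2'.symm)) hii
            · have := hup i j h1 h2
              omega
            · omega
            · have := hup i' j' h1' h2'
              omega
            · exact absurd (he i i' h1.1 h1'.1 (h1.2.1.trans h1'.2.1.symm)) hii
  exact ⟨key.1, fun x y h => (key.2 x y h).1, fun x y h => (key.2 x y h).2⟩

theorem isCircleGraph_melonGraph (hℓ : ∀ i, 1 ≤ ℓ i)
    (h : (Finset.univ.filter fun i => 3 ≤ ℓ i).card ≤ 2) : IsCircleGraph (melonGraph ℓ) := by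
  classical
  -- At most two long paths embed into `Bool`, one per side; the value at other paths is irrelevant.
  obtain ⟨e, he⟩ : ∃ e : Fin m → Bool, ∀ i j, 3 ≤ ℓ i → 3 ≤ ℓ j → e i = e j → i = j := by
    rw [← Fintype.card_subtype, ← Fintype.card_bool] at h
    obtain ⟨f⟩ := Function.Embedding.nonempty_of_card_le h
    refine ⟨fun i => if hi : 3 ≤ ℓ i then f ⟨i, hi⟩ else true, fun i j hi hj hij => ?_⟩
    simp only [hi, hj, dif_pos] at hij
    exact congrArg Subtype.val (f.injective hij)
  have hP : ∀ b, ∃ n, 3 ≤ n ∧ ∀ i, 3 ≤ ℓ i → e i = b → ℓ i = n := fun b => by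
    by_cases hb : ∃ i, 3 ≤ ℓ i ∧ e i = b
    · obtain ⟨i, hi, hib⟩ := hb
      exact ⟨ℓ i, hi, fun j hj hjb => by rw [he i j hi hj (hib.trans hjb.symm)]⟩
    -- A side without a long path gets the dummy length 3, which keeps the ends of source and sink
    -- in the required order.
    · exact ⟨3, le_rfl, fun i hi hib => absurd ⟨i, hi, hib⟩ hb⟩
  choose P hP3 hPℓ using hP
  exact ⟨_, _, isChordDiagram_melonGraph e P hℓ hP3 (fun i hi => hPℓ _ i hi rfl) he⟩

end CircleMelon

/-! ### A word with three occurrences of each letter for every melon graph -/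

section ThreeRepresentation

theorem separates_of_lt {V α : Type*} [LinearOrder α] {p : V → Fin 3 → α} {a b : V}
    (h1 : p a 0 < p b 0) (h2 : p b 0 < p a 1) (h3 : p a 1 < p b 1) (h4 : p b 1 < p a 2)
    (h5 : p a 2 < p b 2) : Separates p a b ∧ Separates p b a := by
  have h02 := h2.trans (h3.trans h4)
  have h02' := h3.trans (h4.trans h5)
  constructor
  · intro i j hij
    fin_cases i <;> fin_cases j <;> simp only [Fin.reduceFinMk, Fin.zero_eta, Fin.mk_one] at hij ⊢
    · exact absurd hij (lt_irrefl _)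
    · exact ⟨0, h1, h2⟩
    · exact ⟨0, h1, h2.trans (h3.trans h4)⟩
    · exact absurd hij (h1.trans h2).not_gt
    · exact absurd hij (lt_irrefl _)
    · exact ⟨1, h3, h4⟩
    · exact absurd hij (h1.trans h02).not_gt
    · exact absurd hij (h3.trans h4).not_gt
    · exact absurd hij (lt_irrefl _)
  · intro i j hij
    fin_cases i <;> fin_cases j <;> simp only [Fin.reduceFinMk, Fin.zero_eta, Fin.mk_one] at hij ⊢
    · exact absurd hij (lt_irrefl _)
    · exact ⟨1, h2, h3⟩
    · exact ⟨1, h2, h3.trans (h4.trans h5)⟩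
    · exact absurd hij (h2.trans h3).not_gt
    · exact absurd hij (lt_irrefl _)
    · exact ⟨2, h4, h5⟩
    · exact absurd hij (h2.trans h02').not_gt
    · exact absurd hij (h4.trans h5).not_gt
    · exact absurd hij (lt_irrefl _)

theorem not_separates {V α : Type*} [LinearOrder α] {p : V → Fin 3 → α} {a b : V}
    (i j : Fin 3) (hij : p a i < p a j) (h0 : p b 0 < p a i ∨ p a j < p b 0)
    (h1 : p b 1 < p a i ∨ p a j < p b 1) (h2 : p b 2 < p a i ∨ p a j < p b 2) :
    ¬ Separates p a b := fun hs => by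
  obtain ⟨l, hl1, hl2⟩ := hs i j hij
  fin_cases l
  · exact h0.elim hl1.not_gt hl2.not_gt
  · exact h1.elim hl1.not_gt hl2.not_gt
  · exact h2.elim hl1.not_gt hl2.not_gt

/-- The place in block `a`, row `b` and column `c`; places are ordered lexicographically. -/
def blockPlace (a b c : ℤ) : ℤ ×ₗ ℤ ×ₗ ℤ := toLex (a, toLex (b, c))

theorem blockPlace_lt {a b c a' b' c' : ℤ} : blockPlace a b c < blockPlace a' b' c' ↔
    a < a' ∨ a = a' ∧ (b < b' ∨ b = b' ∧ c < c') := by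
  simp [blockPlace, Prod.Lex.toLex_lt_toLex]

theorem blockPlace_inj {a b c a' b' c' : ℤ} : blockPlace a b c = blockPlace a' b' c' ↔
    a = a' ∧ b = b' ∧ c = c' := by
  simp [blockPlace]

variable {m : ℕ} {ℓ : Fin m → ℕ}

/-- The places of the vertices of a melon graph in a word representing it; `d` states that the end
points are adjacent. -/
def melonPlace (d : Prop) [Decidable d] : MelonVertex ℓ → Fin 3 → ℤ ×ₗ ℤ ×ₗ ℤ
  | .source => ![blockPlace 2 0 0, blockPlace (if d then 6 else 5) 0 0,
      blockPlace (if d then 12 else 11) 0 0]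
  | .sink => ![blockPlace (if d then 4 else 6) 0 0, blockPlace 9 0 0, blockPlace 13 0 0]
  | .inner i j =>
    if ℓ i < 3 then ![blockPlace (if d then 0 else 4) i 0, blockPlace (if d then 5 else 7) (-i) 0,
      blockPlace (if d then 11 else 12) i 0]
    else ![if j.1 = 0 then blockPlace 1 i 0 else blockPlace 3 (-i) (2 * j - 1),
      if j.1 + 2 = ℓ i then blockPlace 8 i 0 else blockPlace 3 (-i) (2 * j + 2),
      blockPlace 10 (-i) j]

/-- Within block 3 the inner vertices of a long path form a run `v₁ v₀ v₂ v₁ v₃ v₂ …`, in which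
neighbours interleave while for vertices further apart the earlier one has finished before the later
one starts. The first vertex additionally occurs before it, in block 1, and the last one after it,
in block 8, so as to alternate with source and sink; block 10 holds the third occurrences. The rows
`i` and `-i` make the order of the paths alternate between blocks, so that for vertices of distinct
paths one letter is repeated without the other in between. -/
theorem isPlacement_melonPlace [Decidable (∃ i, ℓ i = 1)] :
    IsPlacement (melonPlace (∃ i, ℓ i = 1)) (melonGraph ℓ) := by
  set p := melonPlace (ℓ := ℓ) (∃ i, ℓ i = 1) with hp
  -- The two block orders are treated together: `c0, c1, c2` are the blocks of the paths of length
  -- two, `s1, s2` those of the later occurrences of the source, and `t0` that of the first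
  -- occurrence of the sink.
  obtain ⟨c0, c1, c2, s1, s2, t0, hs, hs0, hs1, hs2, ht0, ht1, ht2, hshort, hd⟩ :
      ∃ c0 c1 c2 s1 s2 t0 : ℤ, (c0 = 0 ∧ t0 = 4 ∧ c1 = 5 ∧ s1 = 6 ∧ c2 = 11 ∧ s2 = 12 ∨
        c0 = 4 ∧ s1 = 5 ∧ t0 = 6 ∧ c1 = 7 ∧ s2 = 11 ∧ c2 = 12) ∧
      p .source 0 = blockPlace 2 0 0 ∧ p .source 1 = blockPlace s1 0 0 ∧
      p .source 2 = blockPlace s2 0 0 ∧ p .sink 0 = blockPlace t0 0 0 ∧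
      p .sink 1 = blockPlace 9 0 0 ∧ p .sink 2 = blockPlace 13 0 0 ∧
      (∀ i j, ℓ i < 3 → p (.inner i j) 0 = blockPlace c0 i 0 ∧
        p (.inner i j) 1 = blockPlace c1 (-i) 0 ∧ p (.inner i j) 2 = blockPlace c2 i 0) ∧
      ((∃ i, ℓ i = 1) ↔ t0 = 4) := by
    by_cases hd : ∃ i, ℓ i = 1
    · refine ⟨0, 5, 11, 6, 12, 4, by simp, rfl, ?_, ?_, ?_, rfl, rfl, fun i j hi => ?_, by simp [hd]⟩
      all_goals simp [p, melonPlace, hd]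
      simp [hi]
    · refine ⟨4, 7, 12, 5, 11, 6, by simp, rfl, ?_, ?_, ?_, rfl, rfl, fun i j hi => ?_, by simpa using hd⟩
      all_goals simp [p, melonPlace, hd]
      simp [hi]
  have hfst : ∀ i (j : Fin (ℓ i - 1)), 3 ≤ ℓ i → j.1 = 0 → p (.inner i j) 0 = blockPlace 1 i 0 ∧
      p (.inner i j) 1 = blockPlace 3 (-i) 2 ∧ p (.inner i j) 2 = blockPlace 10 (-i) 0 := by
    intro i j hi hj
    have : 2 ≠ ℓ i := by omega
    simp [p, melonPlace, hi.not_gt, hj, this]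
  have hlast : ∀ i (j : Fin (ℓ i - 1)), 3 ≤ ℓ i → j.1 + 2 = ℓ i →
      p (.inner i j) 0 = blockPlace 3 (-i) (2 * j - 1) ∧
      p (.inner i j) 1 = blockPlace 8 i 0 ∧ p (.inner i j) 2 = blockPlace 10 (-i) j := by
    intro i j hi hj
    have : j.1 ≠ 0 := by omega
    simp [p, melonPlace, hi.not_gt, this, hj]
  have hmid : ∀ i (j : Fin (ℓ i - 1)), 3 ≤ ℓ i → j.1 ≠ 0 → j.1 + 2 ≠ ℓ i →
      p (.inner i j) 0 = blockPlace 3 (-i) (2 * j - 1) ∧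
      p (.inner i j) 1 = blockPlace 3 (-i) (2 * j + 2) ∧
      p (.inner i j) 2 = blockPlace 10 (-i) j := by
    intro i j hi hj hj'
    simp [p, melonPlace, hi.not_gt, hj, hj']
  clear_value p
  clear hp
  have hcase : ∀ i (j : Fin (ℓ i - 1)),
      (ℓ i = 2 ∧ p (.inner i j) 0 = blockPlace c0 i 0 ∧
        p (.inner i j) 1 = blockPlace c1 (-i) 0 ∧ p (.inner i j) 2 = blockPlace c2 i 0) ∨
      ((3 ≤ ℓ i ∧ j.1 = 0) ∧ p (.inner i j) 0 = blockPlace 1 i 0 ∧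
        p (.inner i j) 1 = blockPlace 3 (-i) 2 ∧ p (.inner i j) 2 = blockPlace 10 (-i) 0) ∨
      ((3 ≤ ℓ i ∧ j.1 ≠ 0 ∧ j.1 + 2 = ℓ i) ∧ p (.inner i j) 0 = blockPlace 3 (-i) (2 * j - 1) ∧
        p (.inner i j) 1 = blockPlace 8 i 0 ∧ p (.inner i j) 2 = blockPlace 10 (-i) j) ∨
      ((3 ≤ ℓ i ∧ j.1 ≠ 0 ∧ j.1 + 2 ≠ ℓ i) ∧ p (.inner i j) 0 = blockPlace 3 (-i) (2 * j - 1) ∧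
        p (.inner i j) 1 = blockPlace 3 (-i) (2 * j + 2) ∧
        p (.inner i j) 2 = blockPlace 10 (-i) j) := by
    intro i j
    have := j.2
    by_cases h1 : ℓ i < 3
    · exact Or.inl ⟨by omega, hshort i j h1⟩
    · by_cases h2 : j.1 = 0
      · exact Or.inr (Or.inl ⟨⟨by omega, h2⟩, hfst i j (by omega) h2⟩)
      · by_cases h3 : j.1 + 2 = ℓ i
        · exact Or.inr (Or.inr (Or.inl ⟨⟨by omega, h2, h3⟩, hlast i j (by omega) h3⟩))
        · exact Or.inr (Or.inr (Or.inr ⟨⟨by omega, h2, h3⟩, hmid i j (by omega) h2 h3⟩))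
  clear hshort hfst hlast hmid
  have source_sink : (melonGraph ℓ).Adj .source .sink ↔
      Separates p .source .sink ∧ Separates p .sink .source := by
    rw [melonGraph_adj_source_sink, hd]
    clear hd
    rcases hs with hs | hs
    · refine iff_of_true hs.2.1 (separates_of_lt ?_ ?_ ?_ ?_ ?_) <;>
        simp only [hs0, hs1, hs2, ht0, ht1, ht2, blockPlace_lt, true_and] <;> omega
    · refine iff_of_false (by omega) fun h => not_separates 0 1 ?_ ?_ ?_ ?_ h.1 <;>
        simp only [hs0, hs1, ht0, ht1, ht2, blockPlace_lt, true_and] <;> omega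
  clear hd
  have inj_same : ∀ x k k', p x k = p x k' → k = k' := by
    rintro (_ | _ | ⟨i, j⟩) k k'
    · fin_cases k <;> fin_cases k' <;>
        simp [hs0, hs1, hs2, blockPlace_inj] <;> omega
    · fin_cases k <;> fin_cases k' <;>
        simp [ht0, ht1, ht2, blockPlace_inj] <;> omega
    · rcases hcase i j with ⟨h1, h2, h3, h4⟩ | ⟨h1, h2, h3, h4⟩ | ⟨h1, h2, h3, h4⟩ | ⟨h1, h2, h3, h4⟩ <;>
        fin_cases k <;> fin_cases k' <;>
        simp [h2, h3, h4, blockPlace_inj] <;> omega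
  have inj_ne : ∀ x y k k', x ≠ y → p x k ≠ p y k' := by
    intro x y k k' hxy
    -- For distinctness it is enough to know which blocks, rows and columns a vertex can occupy. In
    -- block 3 the parity of the column separates first from second occurrences.
    have hinner : ∀ i j k, ∃ a b c, p (.inner i j) k = blockPlace a b c ∧
        ((ℓ i = 2 ∧ (a = c0 ∧ b = i ∨ a = c1 ∧ b = -i ∨ a = c2 ∧ b = i)) ∨
        (3 ≤ ℓ i ∧ (a = 1 ∧ b = i ∧ j.1 = 0 ∨
          a = 3 ∧ b = -i ∧ (c = 2 * j - 1 ∧ j.1 ≠ 0 ∨ c = 2 * j + 2) ∨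
          a = 8 ∧ b = i ∧ j.1 + 2 = ℓ i ∨ a = 10 ∧ b = -i ∧ c = j))) := by
      intro i j k
      rcases hcase i j with ⟨h1, h⟩ | ⟨h1, h⟩ | ⟨h1, h⟩ | ⟨h1, h⟩ <;> fin_cases k <;>
      first
      | exact ⟨_, _, _, h.1, by omega⟩
      | exact ⟨_, _, _, h.2.1, by omega⟩
      | exact ⟨_, _, _, h.2.2, by omega⟩
    have hsource : ∀ k, ∃ a, p .source k = blockPlace a 0 0 ∧ (a = 2 ∨ a = s1 ∨ a = s2) := by
      intro k
      fin_cases k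
      exacts [⟨_, hs0, by simp⟩, ⟨_, hs1, by simp⟩, ⟨_, hs2, by simp⟩]
    have hsink : ∀ k, ∃ a, p .sink k = blockPlace a 0 0 ∧ (a = t0 ∨ a = 9 ∨ a = 13) := by
      intro k
      fin_cases k
      exacts [⟨_, ht0, by simp⟩, ⟨_, ht1, by simp⟩, ⟨_, ht2, by simp⟩]
    rcases x with _ | _ | ⟨i, j⟩ <;> rcases y with _ | _ | ⟨i', j'⟩
    · exact absurd rfl hxy
    · obtain ⟨a, h, ha⟩ := hsource k
      obtain ⟨a', h', ha'⟩ := hsink k'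
      rw [h, h', Ne, blockPlace_inj]
      omega
    · obtain ⟨a, h, ha⟩ := hsource k
      obtain ⟨a', b', c', h', ha'⟩ := hinner i' j' k'
      rw [h, h', Ne, blockPlace_inj]
      omega
    · obtain ⟨a, h, ha⟩ := hsink k
      obtain ⟨a', h', ha'⟩ := hsource k'
      rw [h, h', Ne, blockPlace_inj]
      omega
    · exact absurd rfl hxy
    · obtain ⟨a, h, ha⟩ := hsink k
      obtain ⟨a', b', c', h', ha'⟩ := hinner i' j' k'
      rw [h, h', Ne, blockPlace_inj]
      omega
    · obtain ⟨a, b, c, h, ha⟩ := hinner i j k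
      obtain ⟨a', h', ha'⟩ := hsource k'
      rw [h, h', Ne, blockPlace_inj]
      omega
    · obtain ⟨a, b, c, h, ha⟩ := hinner i j k
      obtain ⟨a', h', ha'⟩ := hsink k'
      rw [h, h', Ne, blockPlace_inj]
      omega
    · obtain ⟨a, b, c, h, ha⟩ := hinner i j k
      obtain ⟨a', b', c', h', ha'⟩ := hinner i' j' k'
      rw [h, h', Ne, blockPlace_inj]
      rw [Ne, MelonVertex.inner_inj] at hxy
      have := j.2
      have := j'.2
      clear h h' hsource hsink hinner
      by_cases hi : i = i'
      · subst hi
        have hj : j.1 ≠ j'.1 := fun h => hxy ⟨rfl, h⟩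
        clear hxy
        omega
      · have hi' : i.1 ≠ i'.1 := fun h => hi (Fin.ext h)
        clear hxy hi
        omega
  constructor
  · rintro ⟨x, k⟩ ⟨y, k'⟩ h
    by_cases hxy : x = y
    · subst hxy
      rw [inj_same x k k' h]
    · exact absurd h (inj_ne x y k k' hxy)
  have symm : ∀ x y, ((melonGraph ℓ).Adj x y ↔ Separates p x y ∧ Separates p y x) →
      ((melonGraph ℓ).Adj y x ↔ Separates p y x ∧ Separates p x y) := fun x y h => by
    rw [SimpleGraph.adj_comm, h, and_comm]
  have source_inner : ∀ i j, (melonGraph ℓ).Adj .source (.inner i j) ↔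
      Separates p .source (.inner i j) ∧ Separates p (.inner i j) .source := by
    intro i j
    have := j.2
    rw [melonGraph_adj_source_inner]
    rcases hcase i j with
      ⟨h1, h2, h3, h4⟩ | ⟨h1, h2, h3, h4⟩ | ⟨h1, h2, h3, h4⟩ | ⟨h1, h2, h3, h4⟩
    · refine iff_of_true (by omega) ?_
      rcases hs with hs | hs
      · refine And.symm (separates_of_lt ?_ ?_ ?_ ?_ ?_) <;>
          simp only [hs0, hs1, hs2, h2, h3, h4, blockPlace_lt] <;> omega
      · refine separates_of_lt ?_ ?_ ?_ ?_ ?_ <;>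
          simp only [hs0, hs1, hs2, h2, h3, h4, blockPlace_lt] <;> omega
    · refine iff_of_true (by omega) (And.symm (separates_of_lt ?_ ?_ ?_ ?_ ?_)) <;>
        simp only [hs0, hs1, hs2, h2, h3, h4, blockPlace_lt] <;> omega
    · refine iff_of_false (by omega) fun h => not_separates 1 2 ?_ ?_ ?_ ?_ h.2 <;>
        simp only [hs0, hs1, hs2, h3, h4, blockPlace_lt] <;> omega
    · refine iff_of_false (by omega) fun h => not_separates 0 1 ?_ ?_ ?_ ?_ h.2 <;>
        simp only [hs0, hs1, hs2, h2, h3, blockPlace_lt, true_and] <;> omega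
  have sink_inner : ∀ i j, (melonGraph ℓ).Adj .sink (.inner i j) ↔
      Separates p .sink (.inner i j) ∧ Separates p (.inner i j) .sink := by
    intro i j
    have := j.2
    rw [melonGraph_adj_sink_inner]
    rcases hcase i j with
      ⟨h1, h2, h3, h4⟩ | ⟨h1, h2, h3, h4⟩ | ⟨h1, h2, h3, h4⟩ | ⟨h1, h2, h3, h4⟩
    · refine iff_of_true (by omega) (And.symm (separates_of_lt ?_ ?_ ?_ ?_ ?_)) <;>
        simp only [ht0, ht1, ht2, h2, h3, h4, blockPlace_lt] <;> omega
    · refine iff_of_false (by omega) fun h => not_separates 0 1 ?_ ?_ ?_ ?_ h.2 <;>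
        simp only [ht0, ht1, ht2, h2, h3, blockPlace_lt] <;> omega
    · refine iff_of_true (by omega) (And.symm (separates_of_lt ?_ ?_ ?_ ?_ ?_)) <;>
        simp only [ht0, ht1, ht2, h2, h3, h4, blockPlace_lt] <;> omega
    · refine iff_of_false (by omega) fun h => not_separates 0 1 ?_ ?_ ?_ ?_ h.2 <;>
        simp only [ht0, ht1, ht2, h2, h3, blockPlace_lt, true_and] <;> omega
  have inner_same : ∀ i (j j' : Fin (ℓ i - 1)), j.1 < j'.1 →
      ((melonGraph ℓ).Adj (.inner i j) (.inner i j') ↔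
      Separates p (.inner i j) (.inner i j') ∧ Separates p (.inner i j') (.inner i j)) := by
    intro i j j' hj
    have := j.2
    have := j'.2
    rw [melonGraph_adj_inner_inner]
    rcases hcase i j with h1 | ⟨h1, h2, h3, h4⟩ | h1 | ⟨h1, h2, h3, h4⟩
    · omega
    · rcases hcase i j' with h1' | h1' | ⟨h1', h2', h3', h4'⟩ | ⟨h1', h2', h3', h4'⟩
      · omega
      · omega
      all_goals
        by_cases hjj : j.1 + 1 = j'.1
        · refine iff_of_true ⟨rfl, by omega⟩ (separates_of_lt ?_ ?_ ?_ ?_ ?_) <;>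
            simp only [h2', h3', h4', h2, h3, h4, blockPlace_lt, true_and] <;> omega
        · refine iff_of_false (by omega) fun h => not_separates 0 1 ?_ ?_ ?_ ?_ h.1 <;>
            simp only [h2', h3', h4', h2, h3, blockPlace_lt, true_and] <;> omega
    · omega
    · rcases hcase i j' with h1' | h1' | ⟨h1', h2', h3', h4'⟩ | ⟨h1', h2', h3', h4'⟩
      · omega
      · omega
      all_goals
        by_cases hjj : j.1 + 1 = j'.1
        · refine iff_of_true ⟨rfl, by omega⟩ (separates_of_lt ?_ ?_ ?_ ?_ ?_) <;>
            simp only [h2', h3', h4', h2, h3, h4, blockPlace_lt, true_and] <;> omega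
        · refine iff_of_false (by omega) fun h => not_separates 0 1 ?_ ?_ ?_ ?_ h.1 <;>
            simp only [h2', h3', h4', h2, h3, blockPlace_lt, true_and] <;> omega
  have inner_ne : ∀ i i' j j', i.1 < i'.1 → ¬ (Separates p (.inner i j) (.inner i' j') ∧
      Separates p (.inner i' j') (.inner i j)) := by
    intro i i' j j' hi h
    have := j.2
    have := j'.2
    rcases hcase i j with
      ⟨h1, h2, h3, h4⟩ | ⟨h1, h2, h3, h4⟩ | ⟨h1, h2, h3, h4⟩ | ⟨h1, h2, h3, h4⟩ <;>
    rcases hcase i' j' with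
      ⟨h1', h2', h3', h4'⟩ | ⟨h1', h2', h3', h4'⟩ |
      ⟨h1', h2', h3', h4'⟩ | ⟨h1', h2', h3', h4'⟩ <;>
    -- In every combination one of the four gaps, first to second or second to third occurrence of
    -- either letter, is free of the other letter.
    first
    | (refine not_separates 0 1 ?_ ?_ ?_ ?_ h.2 <;>
        simp only [h2', h3', h2, h3, h4, blockPlace_lt, true_and] <;> omega)
    | (refine not_separates 1 2 ?_ ?_ ?_ ?_ h.2 <;>
        simp only [h3', h4', h2, h3, h4, blockPlace_lt, true_and] <;> omega)
    | (refine not_separates 0 1 ?_ ?_ ?_ ?_ h.1 <;>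
        simp only [h2', h3', h4', h2, h3, blockPlace_lt, true_and] <;> omega)
    | (refine not_separates 1 2 ?_ ?_ ?_ ?_ h.1 <;>
        simp only [h2', h3', h4', h3, h4, blockPlace_lt] <;> omega)
  rintro (_ | _ | ⟨i, j⟩) (_ | _ | ⟨i', j'⟩) hxy
  · exact absurd rfl hxy
  · exact source_sink
  · exact source_inner _ _
  · exact symm _ _ source_sink
  · exact absurd rfl hxy
  · exact sink_inner _ _
  · exact symm _ _ (source_inner _ _)
  · exact symm _ _ (sink_inner _ _)
  · rw [Ne, MelonVertex.inner_inj] at hxy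
    rcases lt_trichotomy i.1 i'.1 with hi | hi | hi
    · refine iff_of_false ?_ (inner_ne _ _ _ _ hi)
      rw [melonGraph_adj_inner_inner]
      rintro ⟨rfl, -⟩
      exact lt_irrefl _ hi
    · obtain rfl := Fin.ext hi
      rcases lt_trichotomy j.1 j'.1 with hj | hj | hj
      · exact inner_same _ _ _ hj
      · exact absurd ⟨rfl, hj⟩ hxy
      · exact symm _ _ (inner_same _ _ _ hj)
    · refine symm _ _ (iff_of_false ?_ (inner_ne _ _ _ _ hi))
      rw [melonGraph_adj_inner_inner]
      rintro ⟨rfl, -⟩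
      exact lt_irrefl _ hi

end ThreeRepresentation

/-! ### Representation number three means not being a circle graph -/

theorem IsPlacement.comap {V W α : Type*} [LinearOrder α] {k : ℕ} {p : V → Fin k → α}
    {G : SimpleGraph V} {H : SimpleGraph W} (hp : IsPlacement p G) (f : H ↪g G) :
    IsPlacement (fun v => p (f v)) H where
  injective x y h := by
    have := hp.injective (a₁ := (f x.1, x.2)) (a₂ := (f y.1, y.2)) h
    rw [Prod.mk.injEq] at this
    exact Prod.ext (f.injective this.1) this.2
  adj_iff a b hab := by
    rw [← f.map_adj_iff]
    exact hp.adj_iff _ _ (f.injective.ne hab)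

theorem isKWordRepresentable_two_iff {V : Type*} [DecidableEq V] [Finite V]
    {G : SimpleGraph V} : IsKWordRepresentable 2 G ↔ IsCircleGraph G := by
  constructor
  · intro h
    obtain ⟨p, hp⟩ := h.exists_placement
    exact hp.isCircleGraph
  · intro h
    obtain ⟨p, hp⟩ := h.exists_placement
    exact hp.isKWordRepresentable

/-- Letters that occur once always alternate, so the graph is complete, and the word written twice
in succession still represents it. -/
theorem IsKWordRepresentable.two_of_one {V : Type*} [DecidableEq V] [Finite V]
    {G : SimpleGraph V} (h : IsKWordRepresentable 1 G) : IsKWordRepresentable 2 G := by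
  obtain ⟨p, hp⟩ := h.exists_placement
  have hne : ∀ a b, a ≠ b → p a 0 ≠ p b 0 := fun a b hab h =>
    hab (congrArg Prod.fst (hp.injective (a₁ := (a, 0)) (a₂ := (b, 0)) h))
  have hadj : ∀ a b, a ≠ b → G.Adj a b := fun a b hab => (hp.adj_iff a b hab).2
    ⟨fun i j hij => by simp [Subsingleton.elim i j] at hij,
      fun i j hij => by simp [Subsingleton.elim i j] at hij⟩
  let q : V → Fin 2 → ℤ ×ₗ ℤ := fun v i => toLex ((i : ℤ), p v 0)
  have hlt : ∀ a b, p a 0 < p b 0 → Separates q a b ∧ Separates q b a := by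
    intro a b h
    simp [Separates, q, Fin.forall_fin_two, Fin.exists_fin_two, Prod.Lex.toLex_lt_toLex, h,
      h.not_gt]
  refine IsPlacement.isKWordRepresentable (p := q) ⟨?_, fun a b hab => ?_⟩
  · rintro ⟨a, i⟩ ⟨b, j⟩ h
    simp only [q, EmbeddingLike.apply_eq_iff_eq, Prod.mk.injEq, Nat.cast_inj] at h
    exact Prod.ext (by_contra fun hab => hne a b hab h.2) (Fin.ext h.1)
  · refine iff_of_true (hadj a b hab) ?_
    rcases lt_or_gt_of_ne (hne a b hab) with h | h
    · exact hlt a b h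
    · exact (hlt b a h).symm

theorem representationNumber_eq_three_iff {V : Type*} [DecidableEq V] [Finite V]
    {G : SimpleGraph V} (h : IsKWordRepresentable 3 G) :
    representationNumber G = 3 ↔ ¬ IsCircleGraph G := by
  rw [← isKWordRepresentable_two_iff]
  unfold representationNumber
  constructor
  · intro h3 h2
    have := Nat.sInf_le (s := {k | 1 ≤ k ∧ IsKWordRepresentable k G}) ⟨one_le_two, h2⟩
    omega
  · intro h2
    refine le_antisymm (Nat.sInf_le ⟨by norm_num, h⟩) (le_csInf ⟨3, by norm_num, h⟩ ?_)
    rintro k ⟨hk, hG⟩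
    by_contra! hlt
    interval_cases k
    · exact h2 hG.two_of_one
    · exact h2 hG

theorem corollary2p8 {V : Type*} [DecidableEq V] (M : SimpleGraph V) (hM : IsMelonGraph M) :
    representationNumber M = 3 ↔
      ContainsVertexMinor graphM3 M ∨ ContainsVertexMinor (bookGraph 3) M := by
  classical
  obtain ⟨m, ℓ, -, hℓ, h1, ⟨e⟩⟩ := hM
  have : Finite V := Finite.of_equiv _ e.toEquiv.symm
  rw [representationNumber_eq_three_iff
    (isPlacement_melonPlace.comap e.toEmbedding).isKWordRepresentable]
  constructor
  · intro h
    have hcard : 3 ≤ (Finset.univ.filter fun i => 3 ≤ ℓ i).card := by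
      by_contra! hlt
      exact h ((isCircleGraph_melonGraph hℓ (by omega)).comap e.toEmbedding)
    rw [← Fintype.card_subtype, ← Fintype.card_fin 3] at hcard
    obtain ⟨g⟩ := Function.Embedding.nonempty_of_card_le hcard
    exact (melonGraph_containsVertexMinor h1 (g.trans (Function.Embedding.subtype _))
      fun j => (g j).2).imp (·.congr e) (·.congr e)
  · rintro (h | h) hc
    · exact not_isCircleGraph_graphM3 (h.isCircleGraph hc)
    · exact not_isCircleGraph_bookGraph (h.isCircleGraph hc)
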